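/- Let $D:\mathbb R^2\setminus\{0\}\to\mathbb R$ be nonnegative and continuously differentiable, and assume that $D$ is bounded and that $\lim_{x\to 0}\sqrt{|x|}\,\nabla D(x)=0$. Fix $T>0$ and consider the damped Kepler equation $$\ddot x+D(x)\dot x=-\frac{x}{|x|^3},\qquad x\in\mathbb R^2\setminus\{0\},$$ whose solutions are understood to be of class $C^2$ and to avoid the origin. Let $\Omega_T$ be the set of those $(x_0,\dot x_0)\in(\mathbb R^2\setminus\{0\})\times\mathbb R^2$ for which the equation has a (necessarily unique) solution $x:[-T,0]\to\mathbb R^2\setminus\{0\}$ with $x(0)=x_0$ and $\dot x(0)=\dot x_0$. Let $\mathcal P:\Omega_T\to\mathbb R^2\times\mathbb R^2$, $(x_0,\dot x_0)\mapsto(x(-T),\dot x(-T))$, be the backward time-$T$ Poincaré map, and let $\mathcal X:\Omega_T\to\mathbb R^2$, $(x_0,\dot x_0)\mapsto x(-T)$, be its position component. Then $\mathcal X$ admits a continuous extension $\bar{\mathcal X}:(\mathbb R^2\setminus\{0\})\times\mathbb R^2\to\mathbb R^2$. Moreover, $\bar{\mathcal X}(x_0,\lambda x_0)\in\{r x_0: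 r\ge 0\}$ for every $x_0\in\mathbb R^2\setminus\{0\}$ and every $\lambda\in\mathbb R$. -/

import Mathlib

open Set Filter Topology

/-- The plane `ℝ²` with its Euclidean norm. -/
abbrev Plane : Type := EuclideanSpace ℝ (Fin 2)

/-- The acceleration `-D(x) v - x / |x|³` prescribed by the damped Kepler equation. -/
noncomputable def keplerAccel (D : Plane → ℝ) (x v : Plane) : Plane :=
  -(D x • v) - (1 / ‖x‖ ^ 3) • x

/-- `x` is a classical, collision-free solution on `[-T, 0]` of the damped Kepler equation
`ẍ + D(x) ẋ = -x / |x|³`, and `v` is its velocity `ẋ` (one-sided derivatives are taken at the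
endpoints; the equation forces `ẍ` to be continuous, so that `x` is of class `C²`). -/
structure IsDampedKeplerSolution (D : Plane → ℝ) (T : ℝ) (x v : ℝ → Plane) : Prop where
  ne_zero : ∀ t ∈ Icc (-T) 0, x t ≠ 0
  hasDeriv_position : ∀ t ∈ Icc (-T) 0, HasDerivWithinAt x (v t) (Icc (-T) 0) t
  hasDeriv_velocity : ∀ t ∈ Icc (-T) 0,
    HasDerivWithinAt v (keplerAccel D (x t) (v t)) (Icc (-T) 0) t

/-- The graph of the backward time-`T` Poincaré map: some solution on `[-T, 0]` has position and
velocity `p` at time `0`, and position and velocity `q` at time `-T`. -/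
def PoincareGraph (D : Plane → ℝ) (T : ℝ) (p q : Plane × Plane) : Prop :=
  ∃ x v : ℝ → Plane, IsDampedKeplerSolution D T x v ∧
    (x 0, v 0) = p ∧ (x (-T), v (-T)) = q

/-- The domain `Ω_T`: the final data whose solution extends back to time `-T`. -/
def poincareDomain (D : Plane → ℝ) (T : ℝ) : Set (Plane × Plane) :=
  {p | ∃ q, PoincareGraph D T p q}

open Classical in
/-- The backward time-`T` Poincaré map `(x(0), ẋ(0)) ↦ (x(-T), ẋ(-T))` on `Ω_T`
(with the value `0` outside `Ω_T`). -/
noncomputable def poincareMap (D : Plane → ℝ) (T : ℝ) (p : Plane × Plane) : Plane × Plane :=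
  if h : ∃ q, PoincareGraph D T p q then h.choose else 0

/-- The position component of the backward Poincaré map. -/
noncomputable def poincarePosition (D : Plane → ℝ) (T : ℝ) (p : Plane × Plane) : Plane :=
  (poincareMap D T p).1

/-- Final data determine the solution, so the Poincaré map is well defined: its value is the one
given by any solution on `[-T, 0]`. -/
theorem poincareMap_eq (D : Plane → ℝ) (hD : ContDiffOn ℝ 1 D {0}ᶜ) (T : ℝ) (hT : 0 ≤ T)
    (p q : Plane × Plane) (h : PoincareGraph D T p q) : poincareMap D T p = q := by
  have huniq : ∀ q' : Plane × Plane, PoincareGraph D T p q' → q' = q := by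
    rintro q' ⟨y, w, hyw, hp', rfl⟩
    obtain ⟨x, v, hxv, hp, rfl⟩ := h
    have h0 : (y 0, w 0) = (x 0, v 0) := hp'.trans hp.symm
    let F : Plane × Plane → Plane × Plane := fun z => (z.2, keplerAccel D z.1 z.2)
    have hF : ContDiffOn ℝ 1 F ({0}ᶜ ×ˢ univ) := by
      have h1 : ContDiffOn ℝ 1 (fun z : Plane × Plane => z.1) ({0}ᶜ ×ˢ univ) :=
        contDiff_fst.contDiffOn
      have h2 : ContDiffOn ℝ 1 (fun z : Plane × Plane => z.2) ({0}ᶜ ×ˢ univ) :=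
        contDiff_snd.contDiffOn
      have h3 : ContDiffOn ℝ 1 (fun z : Plane × Plane => D z.1) ({0}ᶜ ×ˢ univ) :=
        hD.comp h1 (fun z hz => hz.1)
      have h4 : ContDiffOn ℝ 1 (fun z : Plane × Plane => 1 / ‖z.1‖ ^ 3) ({0}ᶜ ×ˢ univ) :=
        contDiffOn_const.div ((h1.norm ℝ (fun z hz => hz.1)).pow 3)
          (fun z hz => pow_ne_zero 3 (norm_ne_zero_iff.2 hz.1))
      exact h2.prodMk (((h3.smul h2).neg).sub (h4.smul h1))
    have hopen : IsOpen (({0}ᶜ : Set Plane) ×ˢ (univ : Set Plane)) :=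
      isOpen_compl_singleton.prod isOpen_univ
    let f : ℝ → Plane × Plane := fun t => (y t, w t)
    let g : ℝ → Plane × Plane := fun t => (x t, v t)
    have hf : ∀ t ∈ Icc (-T) 0, HasDerivWithinAt f (F (f t)) (Icc (-T) 0) t := fun t ht =>
      (hyw.hasDeriv_position t ht).prodMk (hyw.hasDeriv_velocity t ht)
    have hg : ∀ t ∈ Icc (-T) 0, HasDerivWithinAt g (F (g t)) (Icc (-T) 0) t := fun t ht =>
      (hxv.hasDeriv_position t ht).prodMk (hxv.hasDeriv_velocity t ht)
    have hfc : ContinuousOn f (Icc (-T) 0) := fun t ht => (hf t ht).continuousWithinAt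
    have hgc : ContinuousOn g (Icc (-T) 0) := fun t ht => (hg t ht).continuousWithinAt
    let K : Set (Plane × Plane) := f '' Icc (-T) 0 ∪ g '' Icc (-T) 0
    have hK : IsCompact K := (isCompact_Icc.image_of_continuousOn hfc).union
      (isCompact_Icc.image_of_continuousOn hgc)
    have hKsub : K ⊆ {0}ᶜ ×ˢ univ := by
      rintro z (⟨t, ht, rfl⟩ | ⟨t, ht, rfl⟩)
      · exact ⟨hyw.ne_zero t ht, trivial⟩
      · exact ⟨hxv.ne_zero t ht, trivial⟩
    have hloc : LocallyLipschitzOn K F := by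
      intro z hz
      obtain ⟨C, t, ht, hC⟩ :=
        (hF.contDiffAt (hopen.mem_nhds (hKsub hz))).exists_lipschitzOnWith
      exact ⟨C, t, mem_nhdsWithin_of_mem_nhds ht, hC⟩
    obtain ⟨C, hC⟩ := hloc.exists_lipschitzOnWith_of_compact hK
    have hnhds : ∀ t ∈ Ioc (-T) 0, Icc (-T) 0 ∈ 𝓝[Iic t] t := fun t ht =>
      mem_of_superset (Icc_mem_nhdsLE_of_mem ht) subset_rfl
    have heq : EqOn f g (Icc (-T) 0) :=
      ODE_solution_unique_of_mem_Icc_left (v := fun _ => F) (s := fun _ => K)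
        (fun t _ => hC) hfc
        (fun t ht => (hf t (Ioc_subset_Icc_self ht)).mono_of_mem_nhdsWithin (hnhds t ht))
        (fun t ht => Or.inl ⟨t, Ioc_subset_Icc_self ht, rfl⟩) hgc
        (fun t ht => (hg t (Ioc_subset_Icc_self ht)).mono_of_mem_nhdsWithin (hnhds t ht))
        (fun t ht => Or.inr ⟨t, Ioc_subset_Icc_self ht, rfl⟩) h0
    exact heq ⟨le_rfl, by linarith⟩
  have hex : ∃ q, PoincareGraph D T p q := ⟨q, h⟩
  rw [poincareMap, dif_pos hex]
  exact huniq _ hex.choose_spec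

/-!
The proof is the Levi-Civita regularisation of the equation run backward in time. Identify the
plane with `ℂ`, put `x(-s) = z ^ 2`, and let the dot be the derivative in the fictitious time `τ`
with `ds = |z|² dτ`. With `w = ż` and the energy `E` (half the squared velocity minus `1 / |x|`) as
further unknowns, the equation becomes
`ż = w`, `ẇ = (E / 2) z + d(z) |z|² w`, `Ė = 4 d(z) |w|²`, `ṡ = |z|²`, where `d(z) = D(z ^ 2)`,
on the invariant set `2 |w|² - 1 = E |z|²`, and collisions `z = 0` are no longer singular. The
condition on the gradient of `D` says that `∇d` tends to `0` at the origin, so `d` extends to a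
locally Lipschitz function on `ℂ` (`exists_locallyLipschitz_damping`). Dividing the field by
`1 + ‖·‖²` makes it bounded without changing its orbits, so it has a global continuous flow
(`exists_continuous_global_flow`).

Along every orbit the physical time `s` is strictly increasing, since on the invariant set `z`
cannot vanish on an interval, and it is unbounded (`IsRegularizedCurve.exists_lt_s`). If `s ≤ T`
held for ever, then all quantities would stay bounded for bounded `τ`, so `τ` would be unbounded. The
derivative `G` of `|z|²` satisfies `Ġ = 1 + 2 E |z|² + d |z|² G`, where `E` is bounded below because
`D ≥ 0`, and `∫ |z|² dτ ≤ T`. Hence `G` is eventually at least `1`, and `|z|²` and then `s` diverge,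
a contradiction.

So every orbit meets `s = T` exactly once, at a time depending continuously on the initial data, and
`z ^ 2` there is the extension; it does not depend on the choice of the square root because
`(z, w) ↦ (-z, -w)` is a symmetry. Before the first zero of `z` the orbit projects to a solution of
the Kepler equation, so uniqueness shows that the data in `Ω_T` are those whose orbit has no zero up
to `s = T`, and that the extension agrees with the Poincaré map there
(`IsRegularizedCurve.poincarePosition_eq`). For radial data, `Im (z z̄₀)` and `Im (w z̄₀)` solve a
linear homogeneous system with zero initial values, so `z` stays on the real line through `z₀`
(`IsRegularizedCurve.exists_eq_real_smul`) and `z ^ 2` is a nonnegative multiple of `x₀ = z₀ ^ 2`.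
-/

/-! ### Global flows of bounded locally Lipschitz fields -/

section Flow

variable {V : Type*} [NormedAddCommGroup V] [NormedSpace ℝ V]

theorem mem_closedBall_of_norm_deriv_le_one {g : V → V} (hg1 : ∀ x, ‖g x‖ ≤ 1) {f : ℝ → V} {R : ℝ}
    (hf : ∀ t ∈ Ioo (-R) R, HasDerivAt f (g (f t)) t) {t : ℝ} (ht : t ∈ Ioo (-R) R) :
    f t ∈ Metric.closedBall (f 0) R := by
  have h0 : (0 : ℝ) ∈ Ioo (-R) R := ⟨by linarith [ht.1, ht.2], by linarith [ht.1, ht.2]⟩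
  have := (convex_Ioo (-R) R).norm_image_sub_le_of_norm_hasDerivWithin_le
    (fun s hs => (hf s hs).hasDerivWithinAt) (fun s _ => hg1 (f s)) h0 ht
  rw [Metric.mem_closedBall, dist_eq_norm]
  refine this.trans ?_
  rw [one_mul, sub_zero, Real.norm_eq_abs, abs_le]
  exact ⟨ht.1.le, ht.2.le⟩

theorem LocallyLipschitz.exists_lipschitzOnWith_closedBall {V : Type*} [PseudoMetricSpace V]
    [ProperSpace V] {g : V → V}
    (hg : LocallyLipschitz g) (x : V) (R : ℝ) :
    ∃ K, LipschitzOnWith K g (Metric.closedBall x R) :=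
  (hg.locallyLipschitzOn (s := Metric.closedBall x R)).exists_lipschitzOnWith_of_compact
    (isCompact_closedBall x R)

theorem eqOn_Ioo_of_hasDerivAt_of_norm_le_one [ProperSpace V] {g : V → V}
    (hg : LocallyLipschitz g) (hg1 : ∀ x, ‖g x‖ ≤ 1) {f₁ f₂ : ℝ → V} {R : ℝ}
    (h₁ : ∀ t ∈ Ioo (-R) R, HasDerivAt f₁ (g (f₁ t)) t)
    (h₂ : ∀ t ∈ Ioo (-R) R, HasDerivAt f₂ (g (f₂ t)) t) (h : f₁ 0 = f₂ 0) :
    EqOn f₁ f₂ (Ioo (-R) R) := by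
  intro t ht
  obtain ⟨K, hK⟩ := hg.exists_lipschitzOnWith_closedBall (f₁ 0) R
  have h0 : (0 : ℝ) ∈ Ioo (-R) R := ⟨by linarith [ht.1, ht.2], by linarith [ht.1, ht.2]⟩
  exact ODE_solution_unique_of_mem_Ioo (v := fun _ => g) (s := fun _ => Metric.closedBall (f₁ 0) R)
    (fun _ _ => hK) h0
    (fun s hs => ⟨h₁ s hs, mem_closedBall_of_norm_deriv_le_one hg1 h₁ hs⟩)
    (fun s hs => ⟨h₂ s hs, h ▸ mem_closedBall_of_norm_deriv_le_one hg1 h₂ hs⟩) h ht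

/-- A bounded locally Lipschitz vector field has a global, jointly continuous flow. Boundedness gives
the Picard-Lindelöf theorem on balls and time intervals of arbitrary size at once; the resulting
local flows agree by uniqueness. -/
theorem exists_continuous_global_flow [ProperSpace V] {g : V → V}
    (hg : LocallyLipschitz g) (hg1 : ∀ x, ‖g x‖ ≤ 1) :
    ∃ Φ : V × ℝ → V, Continuous Φ ∧ (∀ x, Φ (x, 0) = x) ∧
      ∀ x t, HasDerivAt (fun s => Φ (x, s)) (g (Φ (x, t))) t := by
  have hloc : ∀ n : ℕ, ∃ α : V × ℝ → V, (∀ x ∈ Metric.closedBall (0 : V) n, α (x, 0) = x ∧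
      ∀ t ∈ Ioo (-(n : ℝ)) n, HasDerivAt (fun s => α (x, s)) (g (α (x, t))) t) ∧
      ContinuousOn α (Metric.closedBall (0 : V) n ×ˢ Icc (-(n : ℝ)) n) := by
    intro n
    obtain ⟨K, hK⟩ := hg.exists_lipschitzOnWith_closedBall (0 : V) (2 * n)
    have hn : (0 : ℝ) ∈ Icc (-(n : ℝ)) n := by simp
    have hPL : IsPicardLindelof (fun _ => g) (⟨0, hn⟩ : Icc (-(n : ℝ)) n) (0 : V)
        (2 * n : NNReal) (n : NNReal) 1 K := by
      refine .of_time_independent (fun x _ => by simpa using hg1 x) (by simpa using hK) ?_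
      simp
      linarith
    obtain ⟨α, hα, hc⟩ :=
      hPL.exists_forall_mem_closedBall_eq_hasDerivWithinAt_continuousOn
    refine ⟨α, fun x hx => ⟨(hα x (by simpa using hx)).1, fun t ht => ?_⟩, by simpa using hc⟩
    exact ((hα x (by simpa using hx)).2 t (Ioo_subset_Icc_self ht)).hasDerivAt
      (Icc_mem_nhds ht.1 ht.2)
  choose α hα hc using hloc
  -- The point `p` lies well inside the domain of the flow with index `N p`.
  let N : V × ℝ → ℕ := fun p => ⌈‖p.1‖ + |p.2|⌉₊ + 1
  have hN : ∀ p : V × ℝ, ‖p.1‖ + |p.2| < N p := fun p => by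
    have := Nat.le_ceil (‖p.1‖ + |p.2|)
    simp only [N]; push_cast; linarith
  have hmem : ∀ (n : ℕ) (p : V × ℝ), ‖p.1‖ + |p.2| < n →
      p.1 ∈ Metric.closedBall (0 : V) n ∧ p.2 ∈ Ioo (-(n : ℝ)) n := by
    intro n p hp
    have h1 := norm_nonneg p.1
    have h2 := abs_nonneg p.2
    refine ⟨by rw [mem_closedBall_zero_iff]; linarith, abs_lt.1 (by linarith)⟩
  have hagree : ∀ (m n : ℕ) (p : V × ℝ), ‖p.1‖ + |p.2| < m → ‖p.1‖ + |p.2| < n →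
      α m p = α n p := by
    have key : ∀ (m n : ℕ) (p : V × ℝ), m ≤ n → ‖p.1‖ + |p.2| < m → α m p = α n p := by
      intro m n p hmn hm
      have hmn' : (m : ℝ) ≤ n := by exact_mod_cast hmn
      have h1 := hmem m p hm
      have h2 := hmem n p (hm.trans_le hmn')
      exact eqOn_Ioo_of_hasDerivAt_of_norm_le_one hg hg1 (f₁ := fun s => α m (p.1, s))
        (f₂ := fun s => α n (p.1, s)) (R := m) (fun t ht => (hα m p.1 h1.1).2 t ht)
        (fun t ht => (hα n p.1 h2.1).2 t ⟨by linarith [ht.1], by linarith [ht.2]⟩)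
        (((hα m p.1 h1.1).1).trans ((hα n p.1 h2.1).1).symm) h1.2
    intro m n p hm hn
    rcases le_total m n with h | h
    · exact key m n p h hm
    · exact (key n m p h hn).symm
  let Φ : V × ℝ → V := fun p => α (N p) p
  have hΦ : ∀ p : V × ℝ, Φ =ᶠ[𝓝 p] α (N p) := by
    intro p
    have hopen : IsOpen {q : V × ℝ | ‖q.1‖ + |q.2| < N p} :=
      isOpen_lt (by fun_prop) continuous_const
    filter_upwards [hopen.mem_nhds (hN p)] with q hq
    exact hagree _ _ q (hN q) hq
  refine ⟨Φ, continuous_iff_continuousAt.2 fun p => ?_, fun x => ?_, fun x t => ?_⟩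
  · have h1 : {q : V × ℝ | ‖q.1‖ + |q.2| < N p} ∈ 𝓝 p :=
      (isOpen_lt (by fun_prop) continuous_const).mem_nhds (hN p)
    refine ContinuousAt.congr ?_ (hΦ p).symm
    refine (hc (N p)).continuousAt (mem_of_superset h1 fun q hq => ?_)
    exact ⟨(hmem _ q hq).1, Ioo_subset_Icc_self (hmem _ q hq).2⟩
  · exact (hα _ x (hmem _ (x, 0) (hN _)).1).1
  · have h1 := hmem _ (x, t) (hN _)
    have h2 := (hα (N (x, t)) x h1.1).2 t h1.2
    refine h2.congr_of_eventuallyEq ?_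
    exact ((Continuous.prodMk_right x).tendsto t).eventually (hΦ (x, t))

end Flow

/-! ### The damping coefficient in the Levi-Civita variable -/

/-- The isometric identification of `ℂ` with the plane, `a + b i ↦ (a, b)`. -/
noncomputable def toPlane : ℂ ≃ₗᵢ[ℝ] Plane := Complex.orthonormalBasisOneI.repr

theorem norm_toPlane_sq (z : ℂ) : ‖toPlane (z ^ 2)‖ = ‖z‖ ^ 2 := by
  rw [toPlane.norm_map, norm_pow]

theorem toPlane_sq_ne_zero {z : ℂ} (hz : z ≠ 0) : toPlane (z ^ 2) ≠ 0 := by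
  rw [← norm_ne_zero_iff, norm_toPlane_sq]
  exact pow_ne_zero 2 (norm_ne_zero_iff.2 hz)

/-- The factor `√|x|` in the condition on `∇D` is exactly the derivative `2 |z|` of `z ↦ z ^ 2`, up to
the constant. -/
theorem exists_hasFDerivAt_comp_toPlane_sq {D : Plane → ℝ} (hD : ContDiffOn ℝ 1 D {0}ᶜ)
    {z : ℂ} (hz : z ≠ 0) :
    ∃ f' : ℂ →L[ℝ] ℝ, HasFDerivAt (fun z : ℂ => D (toPlane (z ^ 2))) f' z ∧
      ‖f'‖ ≤ 2 * (Real.sqrt ‖toPlane (z ^ 2)‖ * ‖gradient D (toPlane (z ^ 2))‖) := by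
  have h0 := toPlane_sq_ne_zero hz
  have h1 : DifferentiableAt ℝ D (toPlane (z ^ 2)) :=
    ((hD.contDiffAt (isOpen_compl_singleton.mem_nhds h0)).differentiableAt (by norm_num))
  have h2 : HasFDerivAt (fun z : ℂ => z ^ 2) _ z :=
    ((hasDerivAt_pow 2 z).hasFDerivAt).restrictScalars ℝ
  have h3 : HasFDerivAt (fun z : ℂ => toPlane (z ^ 2)) _ z :=
    (toPlane.toContinuousLinearEquiv.hasFDerivAt (x := z ^ 2)).comp z h2
  refine ⟨_, h1.hasFDerivAt.comp z h3, ?_⟩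
  have hg : ‖gradient D (toPlane (z ^ 2))‖ = ‖fderiv ℝ D (toPlane (z ^ 2))‖ := by
    simp [gradient]
  rw [hg, norm_toPlane_sq, Real.sqrt_sq (norm_nonneg z)]
  refine ContinuousLinearMap.opNorm_le_bound _ (by positivity) fun v => ?_
  refine ((fderiv ℝ D (toPlane (z ^ 2))).le_opNorm _).trans ?_
  have : ‖toPlane (v * (2 * z))‖ = 2 * ‖z‖ * ‖v‖ := by
    rw [toPlane.norm_map]; simp; ring
  simp at this ⊢
  rw [this]
  apply le_of_eq; ring

/-- A gradient bound on a punctured disc gives a Lipschitz bound there, although the punctured disc is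
not convex; the price is a factor `3`. -/
theorem lipschitzOnWith_punctured_ball {f : ℂ → ℝ} {δ C : ℝ}
    (hf : ∀ z : ℂ, z ≠ 0 → ‖z‖ < δ → ∃ f' : ℂ →L[ℝ] ℝ, HasFDerivAt f f' z ∧ ‖f'‖ ≤ C) :
    LipschitzOnWith (3 * C).toNNReal f (Metric.ball 0 δ \ {0}) := by
  by_cases hne : (Metric.ball (0 : ℂ) δ \ {0}).Nonempty
  swap
  · rw [not_nonempty_iff_eq_empty.1 hne]; simp
  have hC : 0 ≤ C := by
    obtain ⟨z, hz⟩ := hne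
    obtain ⟨f', -, h⟩ := hf z hz.2 (by simpa using hz.1)
    exact (norm_nonneg _).trans h
  choose! f' hf' hfC using hf
  have hseg : ∀ a b : ℂ, ‖a‖ < δ → ‖b‖ < δ → (0 : ℂ) ∉ segment ℝ a b →
      ‖f b - f a‖ ≤ C * ‖b - a‖ := by
    intro a b ha hb h0
    have hne : ∀ z ∈ segment ℝ a b, z ≠ 0 := fun z hz h => h0 (h ▸ hz)
    have hlt : ∀ z ∈ segment ℝ a b, ‖z‖ < δ := fun z hz => by
      have := (convex_ball (0 : ℂ) δ).segment_subset (x := a) (y := b) (by simpa) (by simpa) hz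
      simpa using this
    exact (convex_segment a b).norm_image_sub_le_of_norm_hasFDerivWithin_le
      (fun z hz => (hf' z (hne z hz) (hlt z hz)).hasFDerivWithinAt)
      (fun z hz => hfC z (hne z hz) (hlt z hz)) (left_mem_segment ℝ a b) (right_mem_segment ℝ a b)
  refine LipschitzOnWith.of_dist_le_mul fun a ha b hb => ?_
  rw [Real.coe_toNNReal _ (by positivity), dist_comm, dist_comm a, dist_eq_norm, dist_eq_norm]
  have ha' : ‖a‖ < δ := by simpa using ha.1
  have hb' : ‖b‖ < δ := by simpa using hb.1
  have ha0 : a ≠ 0 := ha.2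
  have hb0 : b ≠ 0 := hb.2
  by_cases h0 : (0 : ℂ) ∈ segment ℝ a b
  swap
  · refine (hseg a b ha' hb' h0).trans ?_
    have := mul_nonneg hC (norm_nonneg (b - a))
    linarith
  -- The segment meets the puncture, so the path turns through a right angle instead.
  obtain ⟨p, q, hp, hq, hpq, hz⟩ := h0
  have hq0 : q ≠ 0 := by
    rintro rfl
    have : p = 1 := by linarith
    simp [this] at hz
    exact ha0 hz
  have hb1 : b = ((-(p / q) : ℝ) : ℂ) * a := by
    have hq' : (q : ℂ) ≠ 0 := by exact_mod_cast hq0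
    simp only [Complex.real_smul] at hz
    push_cast
    field_simp
    linear_combination hz
  set c : ℝ := p / q with hc
  have hc0 : 0 ≤ c := div_nonneg hp hq
  have hind : ∀ r s : ℝ, (r : ℂ) * a + s * (Complex.I * a) = 0 → r = 0 ∧ s = 0 := by
    intro r s h
    have h1 : ((r : ℂ) + s * Complex.I) * a = 0 := by linear_combination h
    have h2 := (mul_eq_zero.1 h1).resolve_right ha0
    have h3 := congrArg Complex.re h2
    have h4 := congrArg Complex.im h2
    simp at h3 h4
    exact ⟨h3, h4⟩
  have hm : ‖Complex.I * a‖ = ‖a‖ := by simp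
  have hs1 : (0 : ℂ) ∉ segment ℝ a (Complex.I * a) := by
    rintro ⟨r, s, -, -, hrs, h⟩
    obtain ⟨rfl, rfl⟩ := hind r s (by simpa [Complex.real_smul] using h)
    norm_num at hrs
  have hs2 : (0 : ℂ) ∉ segment ℝ (Complex.I * a) b := by
    rintro ⟨r, s, -, -, hrs, h⟩
    obtain ⟨h1, h2⟩ := hind (s * -c) r (by
      rw [hb1] at h; simp only [Complex.real_smul] at h; push_cast at h ⊢; linear_combination h)
    have hs : s = 1 := by linarith
    have : c = 0 := by rw [hs] at h1; linarith
    rw [this] at hb1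
    simp at hb1
    exact hb0 hb1
  have hnb : ‖b‖ = c * ‖a‖ := by rw [hb1]; simp [abs_of_nonneg hc0]
  have hba : ‖b - a‖ = ‖a‖ + ‖b‖ := by
    rw [hnb]
    have : b - a = ((-(1 + c) : ℝ) : ℂ) * a := by rw [hb1]; push_cast; ring
    rw [this, norm_mul, Complex.norm_real, Real.norm_eq_abs, abs_neg, abs_of_nonneg (by linarith)]
    ring
  have e1 := hseg a (Complex.I * a) ha' (hm ▸ ha') hs1
  have e2 := hseg (Complex.I * a) b (hm ▸ ha') hb' hs2
  have e3 : ‖Complex.I * a - a‖ ≤ 2 * ‖a‖ := by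
    refine (norm_sub_le _ _).trans ?_; rw [hm]; linarith
  have e4 : ‖b - Complex.I * a‖ ≤ ‖a‖ + ‖b‖ := by
    refine (norm_sub_le _ _).trans ?_; rw [hm]; linarith
  have e5 : ‖f b - f a‖ ≤ ‖f b - f (Complex.I * a)‖ + ‖f (Complex.I * a) - f a‖ := by
    simpa using norm_sub_le_norm_sub_add_norm_sub (f b) (f (Complex.I * a)) (f a)
  rw [hba]
  have e6 := mul_le_mul_of_nonneg_left e3 hC
  have e7 := mul_le_mul_of_nonneg_left e4 hC
  nlinarith [norm_nonneg b, norm_nonneg a, mul_nonneg hC (norm_nonneg b)]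

theorem lipschitzOnWith_of_eqOn {f g : ℂ → ℝ} {s : Set ℂ} {K : NNReal} (hf : LipschitzOnWith K f s)
    (h : EqOn g f s) : LipschitzOnWith K g s := fun x hx y hy => by
  rw [h hx, h hy]
  exact hf hx hy

/-- The function `z ↦ D (z ^ 2)` extends to a locally Lipschitz function on all of `ℂ`. -/
theorem exists_locallyLipschitz_damping {D : Plane → ℝ} (hD : ContDiffOn ℝ 1 D {0}ᶜ)
    (hD_gradient : Tendsto (fun x : Plane => Real.sqrt ‖x‖ • gradient D x) (𝓝[≠] 0) (𝓝 0)) :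
    ∃ d : ℂ → ℝ, LocallyLipschitz d ∧ ∀ z, z ≠ 0 → d z = D (toPlane (z ^ 2)) := by
  obtain ⟨ε, hε, hgrad⟩ : ∃ ε > 0, ∀ x : Plane, x ≠ 0 → ‖x‖ < ε →
      Real.sqrt ‖x‖ * ‖gradient D x‖ ≤ 1 := by
    have h1 := hD_gradient.eventually (Metric.closedBall_mem_nhds (0 : Plane) one_pos)
    rw [eventually_nhdsWithin_iff, Metric.eventually_nhds_iff] at h1
    obtain ⟨ε, hε, h⟩ := h1
    refine ⟨ε, hε, fun x hx hxε => ?_⟩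
    have := h (by simpa using hxε) hx
    simpa [norm_smul, abs_of_nonneg (Real.sqrt_nonneg _)] using this
  have hlip := lipschitzOnWith_punctured_ball (f := fun z : ℂ => D (toPlane (z ^ 2)))
    (δ := Real.sqrt ε) (C := 2) fun z hz hzε => by
      obtain ⟨f', hf', hn⟩ := exists_hasFDerivAt_comp_toPlane_sq hD hz
      refine ⟨f', hf', hn.trans ?_⟩
      have h2 : ‖toPlane (z ^ 2)‖ < ε := by
        rw [norm_toPlane_sq]
        exact (Real.lt_sqrt (norm_nonneg z)).1 hzε
      linarith [hgrad _ (toPlane_sq_ne_zero hz) h2]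
  obtain ⟨g, hg, hgeq⟩ := hlip.extend_real
  -- The Lipschitz extension `g` supplies only the value at the origin.
  refine ⟨Function.update (fun z => D (toPlane (z ^ 2))) 0 (g 0), fun z => ?_, fun z hz => by
    simp [hz]⟩
  by_cases hz : z = 0
  · subst hz
    refine ⟨_, Metric.ball 0 (Real.sqrt ε), Metric.ball_mem_nhds _ (Real.sqrt_pos.2 hε),
      lipschitzOnWith_of_eqOn (hg.lipschitzOnWith (s := Metric.ball 0 (Real.sqrt ε)))
        fun z hz => ?_⟩
    by_cases h0 : z = 0
    · simp [h0]
    · rw [Function.update_of_ne h0]; exact hgeq ⟨hz, h0⟩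
  · have h1 : ContDiffAt ℝ 1 (fun z : ℂ => D (toPlane (z ^ 2))) z := by
      have h2 : ContDiffAt ℝ 1 (fun z : ℂ => toPlane (z ^ 2)) z :=
        (toPlane.contDiff.comp ((contDiff_id (𝕜 := ℝ) (E := ℂ)).pow 2)).contDiffAt
      exact (hD.contDiffAt (isOpen_compl_singleton.mem_nhds (toPlane_sq_ne_zero hz))).comp z h2
    obtain ⟨K, t, ht, hK⟩ := h1.exists_lipschitzOnWith
    refine ⟨K, t ∩ {0}ᶜ, inter_mem ht (isOpen_compl_singleton.mem_nhds hz),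
      lipschitzOnWith_of_eqOn (hK.mono inter_subset_left) fun z hz => ?_⟩
    rw [Function.update_of_ne hz.2]

theorem damping_mem_Icc {D : Plane → ℝ} {M : ℝ} {d : ℂ → ℝ} (hd : Continuous d)
    (hdD : ∀ z, z ≠ 0 → d z = D (toPlane (z ^ 2)))
    (hDM : ∀ x : Plane, x ≠ 0 → D x ∈ Icc 0 M) (z : ℂ) : d z ∈ Icc 0 M := by
  have hcl : IsClosed (d ⁻¹' Icc 0 M) := isClosed_Icc.preimage hd
  have hsub : ({0}ᶜ : Set ℂ) ⊆ d ⁻¹' Icc 0 M := fun z hz => by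
    rw [mem_preimage, hdD z hz]
    exact hDM _ (toPlane_sq_ne_zero hz)
  exact (closure_minimal hsub hcl) ((dense_compl_singleton (0 : ℂ)) z)

/-! ### The regularised vector field and its orbits -/

/-- States `(z, w, E, s, τ, φ)` of the regularised system: Levi-Civita position and velocity, energy,
physical time, fictitious time, and the accumulated damping `φ = ∫ D ds`. The last two components
do not influence the others; they serve as clock and integrating factor. -/
abbrev RegState : Type := ℂ × ℂ × ℝ × ℝ × ℝ × ℝ

/-- The regularised vector field, with respect to the fictitious time `τ`. -/
noncomputable def regField (d : ℂ → ℝ) (Z : RegState) : RegState :=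
  (Z.2.1, (Z.2.2.1 / 2) • Z.1 + (d Z.1 * Complex.normSq Z.1) • Z.2.1,
    4 * d Z.1 * Complex.normSq Z.2.1, Complex.normSq Z.1, 1, d Z.1 * Complex.normSq Z.1)

/-- The regularised vector field, rescaled by a positive factor so that its norm is at most `1`. The
orbits are those of `regField` with another parametrisation. -/
noncomputable def boundedRegField (d : ℂ → ℝ) (Z : RegState) : RegState :=
  (1 + ‖regField d Z‖ ^ 2)⁻¹ • regField d Z

theorem contDiff_normSq : ContDiff ℝ 1 Complex.normSq := by
  have : (Complex.normSq : ℂ → ℝ) = fun z => ‖z‖ ^ 2 := by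
    ext z; exact Complex.normSq_eq_norm_sq z
  rw [this]
  exact contDiff_norm_sq ℝ

theorem LocallyLipschitz.normalize {V W : Type*} [PseudoEMetricSpace V] [NormedAddCommGroup W] [NormedSpace ℝ W]
   {f : V → W} (hf : LocallyLipschitz f) :
    LocallyLipschitz (fun x => (1 + ‖f x‖ ^ 2)⁻¹ • f x) := by
  have hP : ContDiff ℝ 1 (fun Y : W × ℝ => (1 + Y.2 ^ 2)⁻¹ • Y.1) := by
    refine ContDiff.smul (ContDiff.inv (by fun_prop) fun Y => ?_) (by fun_prop)
    positivity
  have h1 : LocallyLipschitz (fun x => (f x, ‖f x‖)) :=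
    hf.prodMk (lipschitzWith_one_norm.locallyLipschitz.comp hf)
  exact hP.locallyLipschitz.comp h1

theorem locallyLipschitz_regField {d : ℂ → ℝ} (hd : LocallyLipschitz d) :
    LocallyLipschitz (regField d) := by
  have hz : ContDiff ℝ 1 (fun Y : RegState × ℝ => Y.1.1) := contDiff_fst.fst
  have hw : ContDiff ℝ 1 (fun Y : RegState × ℝ => Y.1.2.1) := contDiff_fst.snd.fst
  have hE : ContDiff ℝ 1 (fun Y : RegState × ℝ => Y.1.2.2.1) := contDiff_fst.snd.snd.fst
  have hr : ContDiff ℝ 1 (fun Y : RegState × ℝ => Complex.normSq Y.1.1) := contDiff_normSq.comp hz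
  have hv : ContDiff ℝ 1 (fun Y : RegState × ℝ => Complex.normSq Y.1.2.1) := contDiff_normSq.comp hw
  have hdr := (contDiff_snd (𝕜 := ℝ) (n := 1) (E := RegState) (F := ℝ)).mul hr
  have hP := hw.prodMk ((((hE.div_const 2).smul hz).add (hdr.smul hw)).prodMk
    (((contDiff_const (c := (4 : ℝ)).mul contDiff_snd).mul hv).prodMk
      (hr.prodMk ((contDiff_const (c := (1 : ℝ))).prodMk hdr))))
  have h1 : LocallyLipschitz (fun Z : RegState => (Z, d Z.1)) :=
    LocallyLipschitz.id.prodMk (hd.comp LipschitzWith.prod_fst.locallyLipschitz)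
  have h2 := hP.locallyLipschitz.comp h1
  unfold regField
  exact h2

theorem locallyLipschitz_boundedRegField {d : ℂ → ℝ} (hd : LocallyLipschitz d) :
    LocallyLipschitz (boundedRegField d) :=
  (locallyLipschitz_regField hd).normalize

theorem norm_boundedRegField_le_one (d : ℂ → ℝ) (Z : RegState) : ‖boundedRegField d Z‖ ≤ 1 := by
  rw [boundedRegField, norm_smul, Real.norm_of_nonneg (by positivity), inv_mul_le_iff₀ (by positivity)]
  nlinarith [sq_nonneg (‖regField d Z‖ - 1), sq_nonneg ‖regField d Z‖]

/-- The functions `z, w, E, s, τ, φ` form an orbit of the regularised system, traversed with speed `h`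
relative to `τ`, starting at `s = τ = φ = 0` on the invariant set `2 |w|² - 1 = E |z|²`. Of the speed
only positivity, the bound `1`, and a positive lower bound on bounded sets of states are retained. -/
structure IsRegularizedCurve (d : ℂ → ℝ) (z w : ℝ → ℂ) (E s τ φ h : ℝ → ℝ) : Prop where
  speed_pos : ∀ t, 0 < h t
  speed_le_one : ∀ t, h t ≤ 1
  speed_lower : ∀ B : ℝ, ∃ c > 0, ∀ t, ‖((z t, w t, E t, s t, τ t, φ t) : RegState)‖ ≤ B → c ≤ h t
  hasDerivAt_z : ∀ t, HasDerivAt z (h t • w t) t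
  hasDerivAt_w : ∀ t, HasDerivAt w
    (h t • ((E t / 2) • z t + (d (z t) * Complex.normSq (z t)) • w t)) t
  hasDerivAt_E : ∀ t, HasDerivAt E (h t * (4 * d (z t) * Complex.normSq (w t))) t
  hasDerivAt_s : ∀ t, HasDerivAt s (h t * Complex.normSq (z t)) t
  hasDerivAt_τ : ∀ t, HasDerivAt τ (h t) t
  hasDerivAt_φ : ∀ t, HasDerivAt φ (h t * (d (z t) * Complex.normSq (z t))) t
  s_zero : s 0 = 0
  τ_zero : τ 0 = 0
  φ_zero : φ 0 = 0
  energy_zero : 2 * Complex.normSq (w 0) - 1 = E 0 * Complex.normSq (z 0)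

theorem isRegularizedCurve_of_hasDerivAt {d : ℂ → ℝ} (hd : LocallyLipschitz d) {f : ℝ → RegState}
    (hf : ∀ t, HasDerivAt f (boundedRegField d (f t)) t) {z₀ w₀ : ℂ} {E₀ : ℝ}
    (h0 : f 0 = (z₀, w₀, E₀, 0, 0, 0))
    (hE : 2 * Complex.normSq w₀ - 1 = E₀ * Complex.normSq z₀) :
    IsRegularizedCurve d (fun t => (f t).1) (fun t => (f t).2.1) (fun t => (f t).2.2.1)
      (fun t => (f t).2.2.2.1) (fun t => (f t).2.2.2.2.1) (fun t => (f t).2.2.2.2.2)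
      (fun t => (1 + ‖regField d (f t)‖ ^ 2)⁻¹) := by
  have h2 : ∀ t, HasDerivAt (fun t => (f t).2) (boundedRegField d (f t)).2 t := fun t => (hf t).snd
  have h3 : ∀ t, HasDerivAt (fun t => (f t).2.2) (boundedRegField d (f t)).2.2 t :=
    fun t => (h2 t).snd
  have h4 : ∀ t, HasDerivAt (fun t => (f t).2.2.2) (boundedRegField d (f t)).2.2.2 t :=
    fun t => (h3 t).snd
  have h5 : ∀ t, HasDerivAt (fun t => (f t).2.2.2.2) (boundedRegField d (f t)).2.2.2.2 t :=
    fun t => (h4 t).snd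
  have hcont : Continuous (regField d) := (locallyLipschitz_regField hd).continuous
  refine ⟨fun t => by positivity, fun t => inv_le_one_of_one_le₀ (by simp), fun B => ?_, fun t => (hf t).fst, fun t => (h2 t).fst,
    fun t => (h3 t).fst, fun t => (h4 t).fst, fun t => ?_, fun t => (h5 t).snd, by simp [h0],
    by simp [h0], by simp [h0], by simpa [h0] using hE⟩
  · obtain ⟨C, hC⟩ := ((isCompact_closedBall (0 : RegState) B).image hcont).isBounded.exists_norm_le
    refine ⟨(1 + C ^ 2)⁻¹, by positivity, fun t ht => ?_⟩
    have h1 : ‖regField d (f t)‖ ≤ C := hC _ ⟨f t, by simpa using ht, rfl⟩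
    gcongr
  · have h6 : HasDerivAt (fun t => (f t).2.2.2.2.1) (boundedRegField d (f t)).2.2.2.2.1 t :=
      (h5 t).fst
    exact h6.congr_deriv (mul_one _)

theorem le_of_hasDerivAt_nonneg {f f' : ℝ → ℝ} (hf : ∀ t, HasDerivAt f (f' t) t) {a b : ℝ}
    (h : ∀ t, a ≤ t → 0 ≤ f' t) (hab : a ≤ b) : f a ≤ f b := by
  have := monotoneOn_of_deriv_nonneg (convex_Ici a)
    (fun t _ => (hf t).continuousAt.continuousWithinAt)
    (fun t _ => (hf t).differentiableAt.differentiableWithinAt)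
    (fun t ht => by rw [(hf t).deriv]; exact h t (interior_subset ht))
  exact this self_mem_Ici hab hab

theorem HasDerivAt.complex_re {f : ℝ → ℂ} {f' : ℂ} {t : ℝ} (h : HasDerivAt f f' t) :
    HasDerivAt (fun t => (f t).re) f'.re t :=
  Complex.reCLM.hasFDerivAt.comp_hasDerivAt t h

theorem HasDerivAt.complex_im {f : ℝ → ℂ} {f' : ℂ} {t : ℝ} (h : HasDerivAt f f' t) :
    HasDerivAt (fun t => (f t).im) f'.im t :=
  Complex.imCLM.hasFDerivAt.comp_hasDerivAt t h

theorem HasDerivAt.complex_normSq {f : ℝ → ℂ} {f' : ℂ} {t : ℝ} (h : HasDerivAt f f' t) :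
    HasDerivAt (fun t => Complex.normSq (f t)) (2 * ((f t).re * f'.re + (f t).im * f'.im)) t := by
  have h1 := (h.complex_re.mul h.complex_re).add (h.complex_im.mul h.complex_im)
  refine (h1.congr_deriv (by ring)).congr_of_eventuallyEq (.of_forall fun t => ?_)
  simp [Complex.normSq_apply]

namespace IsRegularizedCurve

variable {d : ℂ → ℝ} {z w : ℝ → ℂ} {E s τ φ h : ℝ → ℝ}

/-- The energy relation, which is conserved. -/
theorem energy (hc : IsRegularizedCurve d z w E s τ φ h) (t : ℝ) :
    2 * Complex.normSq (w t) - 1 = E t * Complex.normSq (z t) := by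
  have hder : ∀ t, HasDerivAt
      (fun t => 2 * Complex.normSq (w t) - 1 - E t * Complex.normSq (z t)) 0 t := fun t => by
    refine ((((hc.hasDerivAt_w t).complex_normSq.const_mul 2).sub_const 1).sub
      ((hc.hasDerivAt_E t).mul (hc.hasDerivAt_z t).complex_normSq)).congr_deriv ?_
    simp [Complex.normSq_apply]
    ring
  have := is_const_of_deriv_eq_zero (fun t => (hder t).differentiableAt)
    (fun t => (hder t).deriv) t 0
  have h0 := hc.energy_zero
  linarith

/-- The physical time is strictly increasing: if it stood still on an interval, then `z = 0` and hence
`w = 0` there, against the energy relation. -/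
theorem s_strictMono (hc : IsRegularizedCurve d z w E s τ φ h) : StrictMono s := by
  have hmono : Monotone s := monotone_of_hasDerivAt_nonneg hc.hasDerivAt_s fun t =>
    mul_nonneg (hc.speed_pos t).le (Complex.normSq_nonneg _)
  intro a b hlt
  refine lt_of_le_of_ne (hmono hlt.le) fun hab => ?_
  have hz : ∀ t ∈ Ioo a b, z t = 0 := by
    intro t ht
    have hconst : s =ᶠ[𝓝 t] fun _ => s a := by
      filter_upwards [Ioo_mem_nhds ht.1 ht.2] with u hu
      exact le_antisymm ((hmono hu.2.le).trans hab.symm.le) (hmono hu.1.le)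
    have h1 : h t * Complex.normSq (z t) = 0 :=
      (hc.hasDerivAt_s t).unique ((hasDerivAt_const t (s a)).congr_of_eventuallyEq hconst)
    exact Complex.normSq_eq_zero.1 ((mul_eq_zero.1 h1).resolve_left (hc.speed_pos t).ne')
  have hm : (a + b) / 2 ∈ Ioo a b := ⟨by linarith, by linarith⟩
  have hconst : z =ᶠ[𝓝 ((a + b) / 2)] fun _ => 0 := by
    filter_upwards [Ioo_mem_nhds hm.1 hm.2] with u hu using hz u hu
  have h1 : h ((a + b) / 2) • w ((a + b) / 2) = 0 :=
    (hc.hasDerivAt_z _).unique ((hasDerivAt_const _ 0).congr_of_eventuallyEq hconst)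
  have h2 : w ((a + b) / 2) = 0 := (smul_eq_zero.1 h1).resolve_left (hc.speed_pos _).ne'
  have := hc.energy ((a + b) / 2)
  rw [h2, hz _ hm] at this
  norm_num at this

end IsRegularizedCurve

/-! ### Unboundedness of the physical time -/

namespace IsRegularizedCurve

variable {d : ℂ → ℝ} {z w : ℝ → ℂ} {E s τ φ h : ℝ → ℝ} {M T : ℝ}

theorem hasDerivAt_normSq (hc : IsRegularizedCurve d z w E s τ φ h) (t : ℝ) :
    HasDerivAt (fun t => Complex.normSq (z t))
      (h t * (2 * ((z t).re * (w t).re + (z t).im * (w t).im))) t := by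
  refine (hc.hasDerivAt_z t).complex_normSq.congr_deriv ?_
  simp
  ring

/-- The derivative of `2 Re (z̄ w)`, which is itself the `τ`-derivative of `|z|²`. -/
theorem hasDerivAt_radial (hc : IsRegularizedCurve d z w E s τ φ h) (t : ℝ) :
    HasDerivAt (fun t => 2 * ((z t).re * (w t).re + (z t).im * (w t).im))
      (h t * (1 + 2 * (E t * Complex.normSq (z t)) + d (z t) * Complex.normSq (z t) *
        (2 * ((z t).re * (w t).re + (z t).im * (w t).im)))) t := by
  have hz := hc.hasDerivAt_z t
  have hw := hc.hasDerivAt_w t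
  refine (((hz.complex_re.mul hw.complex_re).add
    (hz.complex_im.mul hw.complex_im)).const_mul 2).congr_deriv ?_
  have := hc.energy t
  simp [Complex.normSq_apply] at this ⊢
  linear_combination h t * this

theorem s_nonneg (hc : IsRegularizedCurve d z w E s τ φ h) {t : ℝ} (ht : 0 ≤ t) : 0 ≤ s t :=
  hc.s_zero ▸ hc.s_strictMono.monotone ht

theorem τ_monotone (hc : IsRegularizedCurve d z w E s τ φ h) : Monotone τ :=
  monotone_of_hasDerivAt_nonneg hc.hasDerivAt_τ fun t => (hc.speed_pos t).le

theorem τ_nonneg (hc : IsRegularizedCurve d z w E s τ φ h) {t : ℝ} (ht : 0 ≤ t) : 0 ≤ τ t :=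
  hc.τ_zero ▸ hc.τ_monotone ht

theorem E_zero_le (hc : IsRegularizedCurve d z w E s τ φ h) (hd : ∀ z, d z ∈ Icc 0 M) {t : ℝ}
    (ht : 0 ≤ t) : E 0 ≤ E t :=
  le_of_hasDerivAt_nonneg hc.hasDerivAt_E (fun t _ => mul_nonneg (hc.speed_pos t).le
    (mul_nonneg (mul_nonneg (by norm_num) (hd _).1) (Complex.normSq_nonneg _))) ht

theorem φ_nonneg (hc : IsRegularizedCurve d z w E s τ φ h) (hd : ∀ z, d z ∈ Icc 0 M) {t : ℝ}
    (ht : 0 ≤ t) : 0 ≤ φ t :=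
  hc.φ_zero ▸ le_of_hasDerivAt_nonneg hc.hasDerivAt_φ (fun t _ => mul_nonneg (hc.speed_pos t).le
    (mul_nonneg (hd _).1 (Complex.normSq_nonneg _))) ht

theorem φ_le (hc : IsRegularizedCurve d z w E s τ φ h) (hd : ∀ z, d z ∈ Icc 0 M) {t : ℝ}
    (ht : 0 ≤ t) : φ t ≤ M * s t := by
  have := le_of_hasDerivAt_nonneg
    (fun t => ((hc.hasDerivAt_s t).const_mul M).sub (hc.hasDerivAt_φ t)) (a := 0) (b := t)
    (fun t _ => by
      have := mul_nonneg (mul_nonneg (hc.speed_pos t).le (Complex.normSq_nonneg (z t)))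
        (sub_nonneg.2 (hd (z t)).2)
      linarith) ht
  simp [hc.s_zero, hc.φ_zero] at this
  exact this

theorem hasDerivAt_radial_mul_exp (hc : IsRegularizedCurve d z w E s τ φ h) (t : ℝ) :
    HasDerivAt (fun t => 2 * ((z t).re * (w t).re + (z t).im * (w t).im) * Real.exp (-φ t))
      (h t * (Real.exp (-φ t) * (1 + 2 * (E t * Complex.normSq (z t))))) t := by
  refine ((hc.hasDerivAt_radial t).mul (hc.hasDerivAt_φ t).neg.exp).congr_deriv ?_
  simp only [Pi.neg_apply]
  ring

/-- If the physical time stays bounded, then so does the fictitious time. -/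
theorem exists_τ_le (hc : IsRegularizedCurve d z w E s τ φ h) (hd : ∀ z, d z ∈ Icc 0 M)
    (hs : ∀ t, 0 ≤ t → s t ≤ T) : ∃ C, ∀ t, 0 ≤ t → τ t ≤ C := by
  have hM : 0 ≤ M := (hd 0).1.trans (hd 0).2
  have hT : 0 ≤ T := hc.s_zero ▸ hs 0 le_rfl
  set G : ℝ → ℝ := fun t => 2 * ((z t).re * (w t).re + (z t).im * (w t).im) with hG
  set K : ℝ := |E 0| with hK
  have hexp : ∀ t, 0 ≤ t → Real.exp (-(M * T)) ≤ Real.exp (-φ t) ∧ Real.exp (-φ t) ≤ 1 := by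
    intro t ht
    have h1 := (hc.φ_le hd ht).trans (mul_le_mul_of_nonneg_left (hs t ht) hM)
    have h2 := hc.φ_nonneg hd ht
    exact ⟨Real.exp_le_exp.2 (by linarith), Real.exp_le_one_iff.2 (by linarith)⟩
  -- The derivative of `G exp (-φ) - exp (-M T) τ + 2 K s` is nonnegative, since `E ≥ -K`.
  have hgrow : ∀ t, 0 ≤ t →
      G 0 + Real.exp (-(M * T)) * τ t - 2 * K * T ≤ G t * Real.exp (-φ t) := by
    intro t ht
    have := le_of_hasDerivAt_nonneg (fun t => ((hc.hasDerivAt_radial_mul_exp t).sub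
      ((hc.hasDerivAt_τ t).const_mul (Real.exp (-(M * T))))).add
      ((hc.hasDerivAt_s t).const_mul (2 * K))) (a := 0) (b := t) (fun t ht => by
        obtain ⟨h1, h2⟩ := hexp t ht
        have h3 : -K ≤ E t := (neg_abs_le _).trans (hc.E_zero_le hd ht)
        have hN := Complex.normSq_nonneg (z t)
        have h4 : -(K * Complex.normSq (z t)) ≤ Real.exp (-φ t) * (E t * Complex.normSq (z t)) := by
          have h5 : -(K * Complex.normSq (z t)) ≤ E t * Complex.normSq (z t) := by nlinarith
          have h6 : 0 ≤ K * Complex.normSq (z t) := mul_nonneg (abs_nonneg _) hN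
          have h7 := mul_le_mul_of_nonneg_left h5 (Real.exp_pos (-φ t)).le
          have h8 := mul_le_mul_of_nonneg_right h2 h6
          linarith
        have h9 := mul_nonneg (hc.speed_pos t).le (a := h t) (b := Real.exp (-φ t) *
          (1 + 2 * (E t * Complex.normSq (z t))) - Real.exp (-(M * T)) +
            2 * K * Complex.normSq (z t)) (by linarith)
        linarith) ht
    simp [hc.s_zero, hc.φ_zero, hc.τ_zero] at this
    have h2 := mul_le_mul_of_nonneg_left (hs t ht) (mul_nonneg zero_le_two (abs_nonneg (E 0)))
    simp only [hG]
    linarith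
  set A : ℝ := (1 + 2 * K * T - G 0) * Real.exp (M * T) with hA
  by_cases hbig : ∃ t₁, 0 ≤ t₁ ∧ A ≤ τ t₁
  swap
  · push Not at hbig
    exact ⟨A, fun t ht => (hbig t ht).le⟩
  obtain ⟨t₁, ht₁, hτ₁⟩ := hbig
  have hG1 : ∀ t, t₁ ≤ t → 1 ≤ G t := by
    intro t ht
    have ht0 := ht₁.trans ht
    have h1 := hgrow t ht0
    have h2 := mul_le_mul_of_nonneg_left (hτ₁.trans (hc.τ_monotone ht))
      (Real.exp_pos (-(M * T))).le
    have h3 : Real.exp (-(M * T)) * A = 1 + 2 * K * T - G 0 := by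
      rw [hA, mul_comm, mul_assoc, ← Real.exp_add]; simp
    have h4 : 1 ≤ G t * Real.exp (-φ t) := by linarith
    have h5 := (hexp t ht0).2
    have h6 := Real.exp_pos (-φ t)
    by_contra hlt
    push Not at hlt
    nlinarith
  have hN : ∀ t, t₁ ≤ t → τ t - τ t₁ ≤ Complex.normSq (z t) := by
    intro t ht
    have := le_of_hasDerivAt_nonneg
      (fun t => (hc.hasDerivAt_normSq t).sub (hc.hasDerivAt_τ t)) (a := t₁) (b := t) (fun t ht => by
        have := mul_nonneg (hc.speed_pos t).le (sub_nonneg.2 (hG1 t ht))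
        simp only [hG] at this
        linarith) ht
    simp at this
    linarith [Complex.normSq_nonneg (z t₁)]
  -- Once `G ≥ 1`, the function `|z|²` outgrows `τ - τ₁`, so `s` outgrows `(τ - τ₁)² / 2`.
  have hS : ∀ t, t₁ ≤ t → (τ t - τ t₁) ^ 2 / 2 ≤ s t := by
    intro t ht
    have := le_of_hasDerivAt_nonneg
      (fun t => (hc.hasDerivAt_s t).sub
        ((((hc.hasDerivAt_τ t).sub_const (τ t₁)).pow 2).div_const 2)) (a := t₁) (b := t)
        (fun t ht => by
          have := mul_nonneg (hc.speed_pos t).le (sub_nonneg.2 (hN t ht))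
          simp
          linarith) ht
    simp at this
    linarith [hc.s_nonneg ht₁]
  refine ⟨τ t₁ + 1 + T, fun t ht => ?_⟩
  rcases le_total t t₁ with h1 | h1
  · linarith [hc.τ_monotone h1]
  · have h2 := hS t h1
    have h3 := hs t ht
    nlinarith [sq_nonneg (T - 1)]

/-- The orbit stays bounded as long as physical and fictitious time are bounded. -/
theorem exists_norm_le (hc : IsRegularizedCurve d z w E s τ φ h) (hd : ∀ z, d z ∈ Icc 0 M)
    (hs : ∀ t, 0 ≤ t → s t ≤ T) {C : ℝ} (hτ : ∀ t, 0 ≤ t → τ t ≤ C) :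
    ∃ B, ∀ t, 0 ≤ t → ‖((z t, w t, E t, s t, τ t, φ t) : RegState)‖ ≤ B := by
  have hM : 0 ≤ M := (hd 0).1.trans (hd 0).2
  have hT : 0 ≤ T := hc.s_zero ▸ hs 0 le_rfl
  have hC : 0 ≤ C := hc.τ_zero ▸ hτ 0 le_rfl
  have hφT : ∀ t, 0 ≤ t → φ t ≤ M * T := fun t ht =>
    (hc.φ_le hd ht).trans (mul_le_mul_of_nonneg_left (hs t ht) hM)
  -- The energy: `E * exp (-2 M s) - 2 M τ` is nonincreasing.
  obtain ⟨K, hK0, hK⟩ : ∃ K, 0 ≤ K ∧ ∀ t, 0 ≤ t → |E t| ≤ K := by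
    refine ⟨|E 0| + (|E 0| + 2 * M * C) * Real.exp (2 * M * T), by positivity, fun t ht => ?_⟩
    have h1 := le_of_hasDerivAt_nonneg (fun t => ((hc.hasDerivAt_τ t).const_mul (2 * M)).sub
      ((hc.hasDerivAt_E t).mul ((hc.hasDerivAt_s t).const_mul (-(2 * M))).exp)) (a := 0) (b := t)
      (fun t ht => by
        set e := Real.exp (-(2 * M) * s t)
        have he0 : 0 < e := Real.exp_pos _
        have he1 : e ≤ 1 := Real.exp_le_one_iff.2 (by
          have := mul_nonneg hM (hc.s_nonneg ht)
          linarith)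
        have h2 : d (z t) * Complex.normSq (w t) ≤ M * Complex.normSq (w t) :=
          mul_le_mul_of_nonneg_right (hd _).2 (Complex.normSq_nonneg _)
        have h3 := hc.energy t
        have h4 : 4 * d (z t) * Complex.normSq (w t) - 2 * M * (E t * Complex.normSq (z t))
            ≤ 2 * M := by rw [← h3]; linarith
        have h5 := mul_le_mul_of_nonneg_right h4 he0.le
        have h6 := mul_le_mul_of_nonneg_left he1 (mul_nonneg zero_le_two hM)
        have h7 := mul_nonneg (hc.speed_pos t).le (a := h t) (b := 2 * M - (4 * d (z t) *
          Complex.normSq (w t) - 2 * M * (E t * Complex.normSq (z t))) * e) (by linarith)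
        linarith) ht
    simp [hc.τ_zero, hc.s_zero] at h1
    have h2 : E t * Real.exp (-(2 * M * s t)) ≤ |E 0| + 2 * M * C := by
      have := mul_le_mul_of_nonneg_left (hτ t ht) (mul_nonneg zero_le_two hM)
      linarith [le_abs_self (E 0)]
    have h3 : E t ≤ (|E 0| + 2 * M * C) * Real.exp (2 * M * T) := by
      have h4 := mul_le_mul_of_nonneg_right h2 (Real.exp_pos (2 * M * s t)).le
      rw [mul_assoc, ← Real.exp_add] at h4
      simp at h4
      refine h4.trans ?_
      have := mul_le_mul_of_nonneg_left (hs t ht) (mul_nonneg zero_le_two hM)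
      gcongr
    have h4 := hc.E_zero_le hd ht
    have h5 : 0 ≤ (|E 0| + 2 * M * C) * Real.exp (2 * M * T) := by positivity
    rw [abs_le]
    constructor
    · linarith [neg_abs_le (E 0)]
    · linarith [abs_nonneg (E 0)]
  -- The radial momentum: `2 re (z̄ w) * exp (-φ)` is controlled by `τ + 2 K s`.
  set G : ℝ → ℝ := fun t => 2 * ((z t).re * (w t).re + (z t).im * (w t).im) with hG
  obtain ⟨L, hL0, hL⟩ : ∃ L, 0 ≤ L ∧ ∀ t, 0 ≤ t → G t ≤ L := by
    refine ⟨(|G 0| + C + 2 * K * T) * Real.exp (M * T), by positivity, fun t ht => ?_⟩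
    have h1 := le_of_hasDerivAt_nonneg (fun t => ((hc.hasDerivAt_τ t).add
      ((hc.hasDerivAt_s t).const_mul (2 * K))).sub (hc.hasDerivAt_radial_mul_exp t))
      (a := 0) (b := t) (fun t ht => by
        have he0 := Real.exp_pos (-φ t)
        have he1 : Real.exp (-φ t) ≤ 1 :=
          Real.exp_le_one_iff.2 (by linarith [hc.φ_nonneg hd ht])
        have hN := Complex.normSq_nonneg (z t)
        have h2 : E t * Complex.normSq (z t) ≤ K * Complex.normSq (z t) :=
          mul_le_mul_of_nonneg_right ((le_abs_self _).trans (hK t ht)) hN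
        have h3 : Real.exp (-φ t) * (1 + 2 * (E t * Complex.normSq (z t)))
            ≤ 1 + 2 * (K * Complex.normSq (z t)) := by
          have h4 := mul_nonneg hK0 hN
          have h5 := mul_le_mul_of_nonneg_left h2 he0.le
          have h6 := mul_le_mul_of_nonneg_right he1 h4
          linarith
        have h7 := mul_nonneg (hc.speed_pos t).le (sub_nonneg.2 h3)
        linarith) ht
    simp [hc.τ_zero, hc.s_zero, hc.φ_zero] at h1
    have h2 : G t * Real.exp (-φ t) ≤ |G 0| + C + 2 * K * T := by
      have h3 := mul_le_mul_of_nonneg_left (hs t ht) (mul_nonneg zero_le_two hK0)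
      have h4 := hτ t ht
      have h5 := le_abs_self (G 0)
      simp only [hG] at h5 ⊢
      linarith
    have h4 := mul_le_mul_of_nonneg_right h2 (Real.exp_pos (φ t)).le
    rw [mul_assoc, ← Real.exp_add] at h4
    simp only [neg_add_cancel, Real.exp_zero, mul_one] at h4
    refine h4.trans ?_
    gcongr
    exact hφT t ht
  obtain ⟨R, hR0, hR⟩ : ∃ R, 0 ≤ R ∧ ∀ t, 0 ≤ t → Complex.normSq (z t) ≤ R := by
    refine ⟨Complex.normSq (z 0) + L * C,
      add_nonneg (Complex.normSq_nonneg _) (by positivity), fun t ht => ?_⟩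
    have h1 := le_of_hasDerivAt_nonneg (fun t => ((hc.hasDerivAt_τ t).const_mul L).sub
      (hc.hasDerivAt_normSq t)) (a := 0) (b := t) (fun t ht => by
        have := mul_nonneg (hc.speed_pos t).le (sub_nonneg.2 (hL t ht))
        simp only [hG] at this
        linarith) ht
    simp [hc.τ_zero] at h1
    have h2 := mul_le_mul_of_nonneg_left (hτ t ht) hL0
    linarith
  have hnorm : ∀ a : ℂ, ∀ S : ℝ, Complex.normSq a ≤ S → ‖a‖ ≤ S + 1 := by
    intro a S ha
    rw [Complex.normSq_eq_norm_sq] at ha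
    nlinarith [sq_nonneg (‖a‖ - 1), sq_nonneg ‖a‖]
  refine ⟨(R + 1) + ((1 + K * R) + 1) + K + T + C + M * T, fun t ht => ?_⟩
  have hz := hnorm _ _ (hR t ht)
  have hw : ‖w t‖ ≤ (1 + K * R) + 1 := by
    refine hnorm _ _ ?_
    have h1 := hc.energy t
    have h2 := mul_le_mul_of_nonneg_right ((le_abs_self _).trans (hK t ht))
      (Complex.normSq_nonneg (z t))
    have h3 := mul_le_mul_of_nonneg_left (hR t ht) hK0
    linarith [mul_nonneg hK0 hR0]
  have hKR := mul_nonneg hK0 hR0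
  have hMT := mul_nonneg hM hT
  have e1 := hK t ht
  have e2 : |s t| ≤ T := by rw [abs_of_nonneg (hc.s_nonneg ht)]; exact hs t ht
  have e3 : |τ t| ≤ C := by rw [abs_of_nonneg (hc.τ_nonneg ht)]; exact hτ t ht
  have e4 : |φ t| ≤ M * T := by rw [abs_of_nonneg (hc.φ_nonneg hd ht)]; exact hφT t ht
  simp only [Prod.norm_def, Real.norm_eq_abs]
  refine max_le ?_ (max_le ?_ (max_le ?_ (max_le ?_ (max_le ?_ ?_)))) <;> linarith

/-- The physical time is unbounded: otherwise the orbit is bounded, so its speed is bounded below and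
`τ` is unbounded, against `exists_τ_le`. -/
theorem exists_lt_s (hc : IsRegularizedCurve d z w E s τ φ h) (hd : ∀ z, d z ∈ Icc 0 M) (T : ℝ) :
    ∃ t, 0 ≤ t ∧ T < s t := by
  by_contra hcon
  push Not at hcon
  obtain ⟨C, hC⟩ := hc.exists_τ_le hd hcon
  obtain ⟨B, hB⟩ := hc.exists_norm_le hd hcon hC
  obtain ⟨c, hc0, hch⟩ := hc.speed_lower B
  have hC0 : 0 ≤ C := hc.τ_zero ▸ hC 0 le_rfl
  have ht : 0 ≤ (C + 1) / c := by positivity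
  have h1 := le_of_hasDerivAt_nonneg (fun t => (hc.hasDerivAt_τ t).sub
    ((hasDerivAt_id t).const_mul c)) (a := 0) (b := (C + 1) / c) (fun t ht => by
      have := hch t (hB t ht)
      linarith) ht
  have h2 : c * ((C + 1) / c) = C + 1 := by field_simp
  simp [hc.τ_zero, h2] at h1
  linarith [hC _ ht]

theorem exists_s_eq (hc : IsRegularizedCurve d z w E s τ φ h) (hd : ∀ z, d z ∈ Icc 0 M)
    (hT : 0 ≤ T) : ∃ t, 0 ≤ t ∧ s t = T := by
  obtain ⟨t₁, ht₁, h1⟩ := hc.exists_lt_s hd T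
  have hcont : Continuous s := continuous_iff_continuousAt.2 fun t => (hc.hasDerivAt_s t).continuousAt
  obtain ⟨t, ht, hst⟩ := intermediate_value_Icc ht₁ hcont.continuousOn
    (show T ∈ Icc (s 0) (s t₁) from ⟨by rw [hc.s_zero]; exact hT, h1.le⟩)
  exact ⟨t, ht.1, hst⟩

end IsRegularizedCurve

/-! ### From regularised orbits to Kepler solutions -/

/-- The algebra behind the change of variables; `z'` and `w'` stand for the conjugates of `z` and `w`. -/
theorem kepler_accel_identity {z z' w w' h E d : ℂ} (hz : z ≠ 0) (hz' : z' ≠ 0) (hh : h ≠ 0)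
    (hE : 2 * (w * w') - 1 = E * (z * z')) :
    -((h * (z * z'))⁻¹ * ((-2 * (h * (E / 2 * z + d * (z * z') * w)) * z' -
      -2 * w * (h * w')) / z' ^ 2)) = -(d * (-2 * w / z')) - 1 / (z * z') ^ 3 * z ^ 2 := by
  field_simp
  linear_combination -hE

/-- The velocity `-2 w / z̄` of the Kepler solution `x(-s) = z ^ 2`. The sign comes from the reversal of
time. -/
noncomputable def keplerVelocity (z w : ℂ) : ℂ := -2 * w / starRingEnd ℂ z

namespace IsRegularizedCurve

variable {d : ℂ → ℝ} {z w : ℝ → ℂ} {E s τ φ h : ℝ → ℝ} {D : Plane → ℝ} {M T : ℝ}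

theorem continuous_s (hc : IsRegularizedCurve d z w E s τ φ h) : Continuous s :=
  continuous_iff_continuousAt.2 fun t => (hc.hasDerivAt_s t).continuousAt

theorem continuous_z (hc : IsRegularizedCurve d z w E s τ φ h) : Continuous z :=
  continuous_iff_continuousAt.2 fun t => (hc.hasDerivAt_z t).continuousAt

theorem continuous_E (hc : IsRegularizedCurve d z w E s τ φ h) : Continuous E :=
  continuous_iff_continuousAt.2 fun t => (hc.hasDerivAt_E t).continuousAt

theorem isOpenEmbedding_s (hc : IsRegularizedCurve d z w E s τ φ h) : IsOpenEmbedding s := by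
  have hoc : OrdConnected (range s) := (isPreconnected_range hc.continuous_s).ordConnected
  refine ⟨hc.s_strictMono.isEmbedding_of_ordConnected hoc, isOpen_iff_mem_nhds.2 ?_⟩
  rintro _ ⟨a, rfl⟩
  exact mem_of_superset (Icc_mem_nhds (hc.s_strictMono (sub_one_lt a))
    (hc.s_strictMono (lt_add_one a))) (hoc.out ⟨_, rfl⟩ ⟨_, rfl⟩)

theorem hasDerivAt_sq_position (hc : IsRegularizedCurve d z w E s τ φ h) {t : ℝ} (ht : z t ≠ 0) :
    HasDerivAt (fun t => z t ^ 2)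
      (-(h t * Complex.normSq (z t)) • keplerVelocity (z t) (w t)) t := by
  refine ((hc.hasDerivAt_z t).pow 2).congr_deriv ?_
  have h1 : starRingEnd ℂ (z t) ≠ 0 := (map_ne_zero _).2 ht
  simp only [keplerVelocity, Complex.real_smul, Complex.ofReal_neg, Complex.ofReal_mul,
    ← Complex.mul_conj]
  field_simp
  simp
  ring

theorem hasDerivAt_keplerVelocity (hc : IsRegularizedCurve d z w E s τ φ h)
    (hdD : ∀ z, z ≠ 0 → d z = D (toPlane (z ^ 2))) {t : ℝ} (ht : z t ≠ 0) :
    HasDerivAt (fun t => toPlane (keplerVelocity (z t) (w t)))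
      (-(h t * Complex.normSq (z t)) •
        keplerAccel D (toPlane (z t ^ 2)) (toPlane (keplerVelocity (z t) (w t)))) t := by
  have h1 : starRingEnd ℂ (z t) ≠ 0 := (map_ne_zero _).2 ht
  have hh : (h t : ℂ) ≠ 0 := by exact_mod_cast (hc.speed_pos t).ne'
  have hconj : HasDerivAt (fun t => starRingEnd ℂ (z t)) (starRingEnd ℂ (h t • w t)) t :=
    Complex.conjCLE.hasFDerivAt.comp_hasDerivAt t (hc.hasDerivAt_z t)
  have h2 := ((hc.hasDerivAt_w t).const_mul (-2 : ℂ)).div hconj h1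
  have h3 := toPlane.toContinuousLinearEquiv.hasFDerivAt.comp_hasDerivAt t h2
  refine h3.congr_deriv ?_
  have hE : 2 * (w t * starRingEnd ℂ (w t)) - 1 = (E t : ℂ) * (z t * starRingEnd ℂ (z t)) := by
    rw [Complex.mul_conj, Complex.mul_conj]; exact_mod_cast hc.energy t
  have key := kepler_accel_identity (d := (d (z t) : ℂ)) ht h1 hh hE
  have hN : (h t * Complex.normSq (z t)) ≠ 0 :=
    mul_ne_zero (hc.speed_pos t).ne' (Complex.normSq_eq_zero.not.2 ht)
  have hacc : keplerAccel D (toPlane (z t ^ 2)) (toPlane (keplerVelocity (z t) (w t))) =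
      toPlane (-((d (z t) : ℂ) * keplerVelocity (z t) (w t)) -
        1 / (z t * starRingEnd ℂ (z t)) ^ 3 * z t ^ 2) := by
    rw [keplerAccel, ← hdD _ ht, norm_toPlane_sq, ← Complex.normSq_eq_norm_sq, Complex.mul_conj,
      map_sub, map_neg, ← map_smul, ← map_smul]
    congr 3
    simp [Complex.real_smul]
  rw [hacc, keplerVelocity, ← key, ← map_smul]
  show toPlane _ = _
  congr 1
  simp only [Complex.real_smul, Complex.ofReal_neg, Complex.ofReal_mul, ← Complex.mul_conj, map_mul,
    Complex.conj_ofReal, Complex.ofReal_div, Complex.ofReal_ofNat]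
  field_simp

/-- As long as `z` does not vanish, a regularised orbit, reparametrised by the physical time, is a
solution of the damped Kepler equation. -/
theorem poincareGraph (hc : IsRegularizedCurve d z w E s τ φ h)
    (hdD : ∀ z, z ≠ 0 → d z = D (toPlane (z ^ 2))) {t₁ : ℝ} (ht₁ : 0 ≤ t₁)
    (hne : ∀ t ∈ Icc 0 t₁, z t ≠ 0) :
    PoincareGraph D (s t₁) (toPlane (z 0 ^ 2), toPlane (keplerVelocity (z 0) (w 0)))
      (toPlane (z t₁ ^ 2), toPlane (keplerVelocity (z t₁) (w t₁))) := by
  -- The inverse of the physical time expresses the orbit in terms of it.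
  let e := hc.isOpenEmbedding_s.toOpenPartialHomeomorph s
  have he : ∀ t, e.symm (s t) = t := fun t => e.left_inv (mem_univ t)
  have hderiv : ∀ {f : ℝ → Plane} {f' : Plane} {u t : ℝ}, z t ≠ 0 → -u = s t →
      HasDerivAt f (-(h t * Complex.normSq (z t)) • f') t →
      HasDerivAt (fun u => f (e.symm (-u))) f' u := by
    intro f f' u t hz hu hf
    have hN : (h t * Complex.normSq (z t)) ≠ 0 :=
      mul_ne_zero (hc.speed_pos t).ne' (Complex.normSq_eq_zero.not.2 hz)
    have h1 : HasDerivAt e.symm (h t * Complex.normSq (z t))⁻¹ (-u) := by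
      refine e.hasDerivAt_symm (hu ▸ ⟨t, mem_univ t, rfl⟩) hN ?_
      rw [hu, he]
      exact hc.hasDerivAt_s t
    have h2 : HasDerivAt (fun u => e.symm (-u)) ((h t * Complex.normSq (z t))⁻¹ * -1) u :=
      h1.comp u (hasDerivAt_neg u)
    have h3 : e.symm (-u) = t := by rw [hu, he]
    rw [← h3] at hf
    refine (hf.scomp u h2).congr_deriv ?_
    rw [h3, smul_smul]
    have h4 : (h t * Complex.normSq (z t))⁻¹ * -1 * -(h t * Complex.normSq (z t)) = 1 := by
      rw [mul_assoc, neg_one_mul, neg_neg, inv_mul_cancel₀ hN]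
    rw [h4, one_smul]
  have hsurj : ∀ u ∈ Icc (-(s t₁)) 0, ∃ t ∈ Icc 0 t₁, -u = s t := by
    intro u hu
    obtain ⟨t, ht, hst⟩ := intermediate_value_Icc ht₁ hc.continuous_s.continuousOn
      (show -u ∈ Icc (s 0) (s t₁) from
        ⟨by rw [hc.s_zero]; linarith [hu.2], by linarith [hu.1]⟩)
    exact ⟨t, ht, hst.symm⟩
  refine ⟨fun u => toPlane (z (e.symm (-u)) ^ 2),
    fun u => toPlane (keplerVelocity (z (e.symm (-u))) (w (e.symm (-u)))), ⟨?_, ?_, ?_⟩, ?_, ?_⟩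
  · intro u hu
    obtain ⟨t, ht, hut⟩ := hsurj u hu
    rw [hut, he]
    exact toPlane_sq_ne_zero (hne t ht)
  · intro u hu
    obtain ⟨t, ht, hut⟩ := hsurj u hu
    refine (hderiv (f := fun t => toPlane (z t ^ 2)) (hne t ht) hut ?_).hasDerivWithinAt
    rw [hut, he, ← map_smul]
    exact toPlane.toContinuousLinearEquiv.hasFDerivAt.comp_hasDerivAt t
      (hc.hasDerivAt_sq_position (hne t ht))
  · intro u hu
    obtain ⟨t, ht, hut⟩ := hsurj u hu
    refine (hderiv (f := fun t => toPlane (keplerVelocity (z t) (w t))) (hne t ht) hut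
      ?_).hasDerivWithinAt
    rw [hut, he]
    exact hc.hasDerivAt_keplerVelocity hdD (hne t ht)
  · have h0 : e.symm (-0) = 0 := by rw [neg_zero, ← hc.s_zero, he, hc.s_zero]
    simp only [h0]
  · simp only [neg_neg, he]

/-- On `Ω_T` the position component of the Poincaré map is read off from the regularised orbit. The
orbit has no zero up to `s = T`, because at the first one the Kepler solution with the same data
would reach the origin. -/
theorem poincarePosition_eq (hc : IsRegularizedCurve d z w E s τ φ h)
    (hD : ContDiffOn ℝ 1 D {0}ᶜ) (hdD : ∀ z, z ≠ 0 → d z = D (toPlane (z ^ 2))) {θ : ℝ}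
    (hθ : 0 ≤ θ) (hp : (toPlane (z 0 ^ 2), toPlane (keplerVelocity (z 0) (w 0))) ∈
      poincareDomain D (s θ)) :
    poincarePosition D (s θ) (toPlane (z 0 ^ 2), toPlane (keplerVelocity (z 0) (w 0))) =
      toPlane (z θ ^ 2) := by
  set p := (toPlane (z 0 ^ 2), toPlane (keplerVelocity (z 0) (w 0)))
  obtain ⟨q, x, v, hxv, hxp, hxq⟩ := hp
  have hsub : ∀ t ∈ Icc 0 θ, Icc (-(s t)) 0 ⊆ Icc (-(s θ)) 0 := fun t ht =>
    Icc_subset_Icc_left (neg_le_neg (hc.s_strictMono.monotone ht.2))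
  have hagree : ∀ t ∈ Icc 0 θ, (∀ u ∈ Icc 0 t, z u ≠ 0) → x (-(s t)) = toPlane (z t ^ 2) := by
    intro t ht hne
    have h1 : PoincareGraph D (s t) p (x (-(s t)), v (-(s t))) :=
      ⟨x, v, ⟨fun u hu => hxv.ne_zero u (hsub t ht hu),
        fun u hu => (hxv.hasDeriv_position u (hsub t ht hu)).mono (hsub t ht),
        fun u hu => (hxv.hasDeriv_velocity u (hsub t ht hu)).mono (hsub t ht)⟩, hxp, rfl⟩
    have h2 := poincareMap_eq D hD (s t) (hc.s_nonneg ht.1) p _ h1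
    rw [poincareMap_eq D hD (s t) (hc.s_nonneg ht.1) p _ (hc.poincareGraph hdD ht.1 hne)] at h2
    exact (congrArg Prod.fst h2).symm
  have hne : ∀ t ∈ Icc 0 θ, z t ≠ 0 := by
    by_contra hcon
    push Not at hcon
    have hcomp : IsCompact (Icc 0 θ ∩ z ⁻¹' {0}) :=
      isCompact_Icc.inter_right (isClosed_singleton.preimage hc.continuous_z)
    obtain ⟨t₁, ⟨ht₁, hz₁⟩, hleast⟩ := hcomp.exists_isLeast hcon
    have hx : ∀ t ∈ Icc 0 θ, x (-(s t)) ≠ 0 := fun t ht =>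
      hxv.ne_zero _ ⟨neg_le_neg (hc.s_strictMono.monotone ht.2), by linarith [hc.s_nonneg ht.1]⟩
    have hbefore : ∀ t, t < t₁ → 0 ≤ t → z t ≠ 0 := fun t ht h0 hz =>
      absurd (hleast ⟨⟨h0, ht.le.trans ht₁.2⟩, hz⟩) (not_le.2 ht)
    have hpos : 0 < t₁ := by
      refine lt_of_le_of_ne ht₁.1 fun h0 => ?_
      have hz0 : z 0 = 0 := by rw [h0]; exact hz₁
      refine hx 0 ⟨le_rfl, hθ⟩ ?_
      have hx0 : x 0 = toPlane (z 0 ^ 2) := congrArg Prod.fst hxp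
      rw [hc.s_zero, neg_zero, hx0, hz0]
      simp
    have heq : EqOn (fun t => x (-(s t))) (fun t => toPlane (z t ^ 2)) (Ico 0 t₁) := fun t ht =>
      hagree t ⟨ht.1, ht.2.le.trans ht₁.2⟩ fun u hu => hbefore u (hu.2.trans_lt ht.2) hu.1
    have hxc : ContinuousOn x (Icc (-(s θ)) 0) := fun u hu =>
      (hxv.hasDeriv_position u hu).continuousWithinAt
    have hcl : EqOn (fun t => x (-(s t))) (fun t => toPlane (z t ^ 2)) (Icc 0 t₁) := by
      refine heq.of_subset_closure (hxc.comp hc.continuous_s.neg.continuousOn fun t ht => ?_)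
        (toPlane.continuous.comp (hc.continuous_z.pow 2)).continuousOn Ico_subset_Icc_self ?_
      · exact ⟨neg_le_neg (hc.s_strictMono.monotone (ht.2.trans ht₁.2)),
          by linarith [hc.s_nonneg ht.1]⟩
      · rw [closure_Ico hpos.ne]
    have h2 := hcl (right_mem_Icc.2 hpos.le)
    have hz₁' : z t₁ = 0 := hz₁
    simp only [hz₁'] at h2
    exact hx t₁ ht₁ (by simpa using h2)
  rw [poincarePosition, poincareMap_eq D hD (s θ) (hc.s_nonneg hθ) p _ (hc.poincareGraph hdD hθ hne)]

/-- An orbit with radial initial velocity stays on the real line through its initial position. -/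
theorem exists_eq_real_smul (hc : IsRegularizedCurve d z w E s τ φ h) (hd : Continuous d)
    (hz0 : z 0 ≠ 0) {c : ℝ} (hw0 : w 0 = c • z 0) {t : ℝ} (ht : 0 ≤ t) :
    ∃ a : ℝ, z t = a • z 0 := by
  -- `L = Im (z z̄₀)` and `P = Im (w z̄₀)`.
  let L : ℝ → ℝ := fun t => (z t).im * (z 0).re - (z t).re * (z 0).im
  let P : ℝ → ℝ := fun t => (w t).im * (z 0).re - (w t).re * (z 0).im
  have hL : ∀ t, HasDerivAt L (h t * P t) t := fun t => by
    refine (((hc.hasDerivAt_z t).complex_im.mul_const _).sub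
      ((hc.hasDerivAt_z t).complex_re.mul_const _)).congr_deriv ?_
    simp [P]
    ring
  have hP : ∀ t, HasDerivAt P
      (h t * (E t / 2 * L t + d (z t) * Complex.normSq (z t) * P t)) t := fun t => by
    refine (((hc.hasDerivAt_w t).complex_im.mul_const _).sub
      ((hc.hasDerivAt_w t).complex_re.mul_const _)).congr_deriv ?_
    simp [P, L]
    ring
  have hcE := hc.continuous_E
  have hcz := hc.continuous_z
  have hcoef : Continuous fun t => |E t / 2| + |d (z t) * Complex.normSq (z t)| :=
    ((hcE.div_const 2).abs).add
      (((hd.comp hcz).mul (Complex.continuous_normSq.comp hcz)).abs)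
  obtain ⟨K, hK⟩ := (isCompact_Icc (a := (0 : ℝ)) (b := t)).exists_bound_of_continuousOn
    hcoef.continuousOn
  have hzero := eq_zero_of_abs_deriv_le_mul_abs_self_of_eq_zero_right
    (f := fun t => (L t, P t)) (K := 1 + K) (a := 0) (b := t)
    (fun u _ => ((hL u).prodMk (hP u)).continuousAt.continuousWithinAt)
    (fun u _ => ((hL u).prodMk (hP u)).hasDerivWithinAt)
    (by simp [L, P, hw0]; constructor <;> ring)
    (fun u hu => by
      have h1 := hK u (Ico_subset_Icc_self hu)
      rw [Real.norm_of_nonneg (by positivity)] at h1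
      have hl : |L u| ≤ ‖(L u, P u)‖ := norm_fst_le (L u, P u)
      have hp : |P u| ≤ ‖(L u, P u)‖ := norm_snd_le (L u, P u)
      set m := ‖(L u, P u)‖
      have hm : 0 ≤ m := norm_nonneg _
      have hh0 := (hc.speed_pos u).le
      have hh1 := hc.speed_le_one u
      have hK0 : 0 ≤ K := le_trans (by positivity) h1
      have hmul : ∀ y B : ℝ, |y| ≤ B → |h u * y| ≤ B := fun y B hy => by
        rw [abs_mul, abs_of_nonneg hh0]
        nlinarith [abs_nonneg y]
      rw [Prod.norm_def]
      refine max_le (hmul _ _ ?_) (hmul _ _ ?_)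
      · nlinarith [mul_nonneg hK0 hm]
      · refine (abs_add_le _ _).trans ?_
        rw [abs_mul, abs_mul _ (P u)]
        nlinarith [mul_le_mul_of_nonneg_left hl (abs_nonneg (E u / 2)),
          mul_le_mul_of_nonneg_left hp (abs_nonneg (d (z u) * Complex.normSq (z u))),
          mul_le_mul_of_nonneg_right h1 hm])
    t (right_mem_Icc.2 ht)
  have hLt : (z t).im * (z 0).re - (z t).re * (z 0).im = 0 := congrArg Prod.fst hzero
  have hN : (z 0).re * (z 0).re + (z 0).im * (z 0).im ≠ 0 := by
    rw [← Complex.normSq_apply]; exact Complex.normSq_eq_zero.not.2 hz0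
  refine ⟨((z t).re * (z 0).re + (z t).im * (z 0).im) /
    ((z 0).re * (z 0).re + (z 0).im * (z 0).im), ?_⟩
  apply Complex.ext
  · simp only [Complex.smul_re, smul_eq_mul]
    rw [div_mul_eq_mul_div, eq_div_iff hN]
    linear_combination (-(z 0).im) * hLt
  · simp only [Complex.smul_im, smul_eq_mul]
    rw [div_mul_eq_mul_div, eq_div_iff hN]
    linear_combination ((z 0).re) * hLt

end IsRegularizedCurve

/-! ### Initial data, square roots and the extension -/

/-- The initial state with Levi-Civita position `ζ` that represents the Kepler data of position `ζ ^ 2`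
and velocity `η`. The energy is chosen so that the energy relation holds. -/
noncomputable def regInitial (ζ η : ℂ) : RegState :=
  (ζ, -(starRingEnd ℂ ζ * η / 2),
    (2 * Complex.normSq (-(starRingEnd ℂ ζ * η / 2)) - 1) / Complex.normSq ζ, 0, 0, 0)

theorem keplerVelocity_regInitial {ζ : ℂ} (hζ : ζ ≠ 0) (η : ℂ) :
    keplerVelocity ζ (-(starRingEnd ℂ ζ * η / 2)) = η := by
  have h1 : starRingEnd ℂ ζ ≠ 0 := (map_ne_zero _).2 hζ
  rw [keplerVelocity]
  field_simp

theorem continuousAt_regInitial {X : Type*} [TopologicalSpace X] {ζ η : X → ℂ} {p : X}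
    (hζ : ContinuousAt ζ p) (hη : ContinuousAt η p) (h0 : ζ p ≠ 0) :
    ContinuousAt (fun q => regInitial (ζ q) (η q)) p := by
  have hw : ContinuousAt (fun q => -(starRingEnd ℂ (ζ q) * η q / 2)) p :=
    (((Complex.continuous_conj.continuousAt.comp hζ).mul hη).div_const 2).neg
  exact hζ.prodMk (hw.prodMk (ContinuousAt.prodMk
    ((((Complex.continuous_normSq.continuousAt.comp hw).const_mul 2).sub continuousAt_const).div
      (Complex.continuous_normSq.continuousAt.comp hζ) (Complex.normSq_eq_zero.not.2 h0))
    continuousAt_const))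

/-- The symmetry `(z, w) ↦ (-z, -w)`, which exchanges the two square roots of the position. -/
noncomputable def negState (Z : RegState) : RegState := (-Z.1, -Z.2.1, Z.2.2)

theorem boundedRegField_negState {d : ℂ → ℝ} (hd : ∀ z, d (-z) = d z) (Z : RegState) :
    boundedRegField d (negState Z) = negState (boundedRegField d Z) := by
  have h1 : regField d (negState Z) = negState (regField d Z) := by
    simp only [regField, negState, hd, Complex.normSq_neg, smul_neg, neg_add]
  have h2 : ∀ Y : RegState, ‖negState Y‖ = ‖Y‖ := fun Y => by
    simp [negState, Prod.norm_def]
  rw [boundedRegField, h1, h2, boundedRegField]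
  simp [negState]

theorem regInitial_neg (ζ η : ℂ) : regInitial (-ζ) η = negState (regInitial ζ η) := by
  simp [regInitial, negState, neg_div]

theorem hasDerivAt_negState {f : ℝ → RegState} {f' : RegState} {t : ℝ} (hf : HasDerivAt f f' t) :
    HasDerivAt (fun t => negState (f t)) (negState f') t := by
  have h1 : HasDerivAt (fun t => (f t).2) f'.2 t := hf.snd
  have h2 : HasDerivAt (fun t => (f t).1) f'.1 t := hf.fst
  have h3 : HasDerivAt (fun t => (f t).2.1) f'.2.1 t := h1.fst
  have h4 : HasDerivAt (fun t => (f t).2.2) f'.2.2 t := h1.snd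
  exact h2.neg.prodMk (h3.neg.prodMk h4)

/-- The time at which a strictly increasing function takes a given value depends continuously on
parameters. -/
theorem continuousAt_of_strictMono_crossing {X : Type*} [TopologicalSpace X] {S : X → ℝ → ℝ}
    {θ : X → ℝ} {T : ℝ} {p : X} (hS : ∀ t, ContinuousAt (fun q => S q t) p)
    (hmono : ∀ᶠ q in 𝓝 p, StrictMono (S q) ∧ S q (θ q) = T) : ContinuousAt θ p := by
  obtain ⟨hp, hpT⟩ := hmono.self_of_nhds
  rw [Metric.continuousAt_iff']
  intro ε hε
  have h1 : S p (θ p - ε) < T := hpT ▸ hp (by linarith)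
  have h2 : T < S p (θ p + ε) := hpT ▸ hp (by linarith)
  filter_upwards [hmono, (hS _).eventually_lt_const h1, (hS _).eventually_const_lt h2]
    with q hq hq1 hq2
  rw [← hq.2] at hq1 hq2
  have h3 := hq.1.lt_iff_lt.1 hq1
  have h4 := hq.1.lt_iff_lt.1 hq2
  rw [Real.dist_eq, abs_lt]
  constructor <;> linarith

/-- Near every nonzero point there is a branch of the square root, here with a value everywhere, that is
continuous at the point. -/
theorem exists_continuousAt_sqrt {a : ℂ} (ha : a ≠ 0) :
    ∃ r : ℂ → ℂ, ContinuousAt r a ∧ ∀ x, r x ^ 2 = x := by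
  have hsq : ∀ x : ℂ, (x ^ ((2 : ℕ) : ℂ)⁻¹) ^ 2 = x := fun x =>
    Complex.cpow_nat_inv_pow x two_ne_zero
  by_cases h : a ∈ Complex.slitPlane
  · exact ⟨fun x => x ^ ((2 : ℕ) : ℂ)⁻¹, continuousAt_cpow_const h, hsq⟩
  · refine ⟨fun x => Complex.I * (-x) ^ ((2 : ℕ) : ℂ)⁻¹, ?_, fun x => ?_⟩
    · refine continuousAt_const.mul (ContinuousAt.comp (f := fun x : ℂ => -x)
        (g := fun x : ℂ => x ^ ((2 : ℕ) : ℂ)⁻¹) (continuousAt_cpow_const ?_) continuousAt_neg)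
      rw [Complex.mem_slitPlane_iff] at h ⊢
      push Not at h
      left
      have : a.re ≠ 0 := fun h0 => ha (Complex.ext h0 h.2)
      simpa using lt_of_le_of_ne h.1 this
    · rw [mul_pow, hsq, Complex.I_sq, neg_one_mul, neg_neg]

theorem proposition3 (D : Plane → ℝ)
    (hD : ContDiffOn ℝ 1 D {0}ᶜ)
    (hD_nonneg : ∀ x : Plane, x ≠ 0 → 0 ≤ D x)
    (hD_bounded : ∃ M : ℝ, ∀ x : Plane, x ≠ 0 → |D x| ≤ M)
    (hD_gradient : Tendsto (fun x : Plane => Real.sqrt ‖x‖ • gradient D x) (𝓝[≠] 0) (𝓝 0))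
    (T : ℝ) (hT : 0 < T) :
    ∃ Xbar : Plane × Plane → Plane,
      ContinuousOn Xbar ({0}ᶜ ×ˢ univ) ∧
      EqOn Xbar (poincarePosition D T) (poincareDomain D T) ∧
      ∀ x₀ : Plane, x₀ ≠ 0 → ∀ c : ℝ, ∃ r : ℝ, 0 ≤ r ∧ Xbar (x₀, c • x₀) = r • x₀ := by
  obtain ⟨M, hM⟩ := hD_bounded
  obtain ⟨d, hd, hdD⟩ := exists_locallyLipschitz_damping hD hD_gradient
  have hdM : ∀ z, d z ∈ Icc 0 M := damping_mem_Icc hd.continuous hdD fun x hx =>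
    ⟨hD_nonneg x hx, (le_abs_self _).trans (hM x hx)⟩
  have hdneg : ∀ z, d (-z) = d z := fun z => by
    by_cases hz : z = 0
    · rw [hz, neg_zero]
    · rw [hdD z hz, hdD _ (neg_ne_zero.2 hz), neg_sq]
  have hg := locallyLipschitz_boundedRegField hd
  obtain ⟨Φ, hΦc, hΦ0, hΦ⟩ := exists_continuous_global_flow hg (norm_boundedRegField_le_one d)
  have hcurve : ∀ (ζ η : ℂ), ζ ≠ 0 → IsRegularizedCurve d (fun t => (Φ (regInitial ζ η, t)).1)
      (fun t => (Φ (regInitial ζ η, t)).2.1) (fun t => (Φ (regInitial ζ η, t)).2.2.1)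
      (fun t => (Φ (regInitial ζ η, t)).2.2.2.1) (fun t => (Φ (regInitial ζ η, t)).2.2.2.2.1)
      (fun t => (Φ (regInitial ζ η, t)).2.2.2.2.2)
      (fun t => (1 + ‖regField d (Φ (regInitial ζ η, t))‖ ^ 2)⁻¹) := fun ζ η hζ =>
    isRegularizedCurve_of_hasDerivAt hd (hΦ _) (hΦ0 _)
      (div_mul_cancel₀ _ (Complex.normSq_eq_zero.not.2 hζ)).symm
  have hcross : ∀ (ζ η : ℂ), ∃ t, ζ ≠ 0 → 0 ≤ t ∧ (Φ (regInitial ζ η, t)).2.2.2.1 = T :=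
    fun ζ η => by
      by_cases hζ : ζ = 0
      · exact ⟨0, fun h => absurd hζ h⟩
      · obtain ⟨t, ht⟩ := (hcurve ζ η hζ).exists_s_eq hdM hT.le
        exact ⟨t, fun _ => ht⟩
  choose θ hθ using hcross
  let Y : ℂ → ℂ → Plane := fun ζ η => toPlane ((Φ (regInitial ζ η, θ ζ η)).1 ^ 2)
  have hYneg : ∀ ζ η, ζ ≠ 0 → Y (-ζ) η = Y ζ η := by
    intro ζ η hζ
    have hsym : ∀ t, Φ (regInitial (-ζ) η, t) = negState (Φ (regInitial ζ η, t)) := fun t =>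
      eqOn_Ioo_of_hasDerivAt_of_norm_le_one hg (norm_boundedRegField_le_one d) (R := |t| + 1)
        (f₁ := fun t => Φ (regInitial (-ζ) η, t)) (f₂ := fun t => negState (Φ (regInitial ζ η, t)))
        (fun t _ => hΦ _ t)
        (fun t _ => by
          rw [boundedRegField_negState hdneg]
          exact hasDerivAt_negState (hΦ _ t))
        (by simp only [hΦ0, regInitial_neg]) (abs_lt.1 (lt_add_one |t|))
    have h1 := (hθ (-ζ) η (neg_ne_zero.2 hζ)).2
    rw [hsym] at h1
    have h2 : θ (-ζ) η = θ ζ η :=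
      (hcurve ζ η hζ).s_strictMono.injective (h1.trans (hθ ζ η hζ).2.symm)
    simp only [Y, h2, hsym, negState, neg_sq]
  have hYcont : ∀ (ζ η : Plane × Plane → ℂ) (p : Plane × Plane), ContinuousAt ζ p →
      ContinuousAt η p → ζ p ≠ 0 → ContinuousAt (fun q => Y (ζ q) (η q)) p := by
    intro ζ η p hζ hη h0
    have hι := continuousAt_regInitial hζ hη h0
    have hθc : ContinuousAt (fun q => θ (ζ q) (η q)) p := by
      refine continuousAt_of_strictMono_crossing (T := T)
        (S := fun q t => (Φ (regInitial (ζ q) (η q), t)).2.2.2.1) (fun t => ?_) ?_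
      · exact (hΦc.continuousAt.comp (hι.prodMk continuousAt_const)).snd.snd.snd.fst
      · filter_upwards [hζ.eventually_ne h0] with q hq
        exact ⟨(hcurve _ _ hq).s_strictMono, (hθ _ _ hq).2⟩
    have h1 : ContinuousAt (fun q => (Φ (regInitial (ζ q) (η q), θ (ζ q) (η q))).1) p :=
      (hΦc.continuousAt.comp (hι.prodMk hθc)).fst
    exact toPlane.continuous.continuousAt.comp (h1.pow 2)
  -- The principal square root jumps on the negative axis; the symmetry of `Y` removes the jump.
  let ρ : ℂ → ℂ := fun x => x ^ ((2 : ℕ) : ℂ)⁻¹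
  have hρ : ∀ x, ρ x ^ 2 = x := fun x => Complex.cpow_nat_inv_pow x two_ne_zero
  have hne : ∀ (x : Plane) (ζ : ℂ), x ≠ 0 → ζ ^ 2 = toPlane.symm x → ζ ≠ 0 := by
    rintro x ζ hx hζ rfl
    refine hx (toPlane.symm.map_eq_zero_iff.1 ?_)
    rw [← hζ]; simp
  refine ⟨fun p => Y (ρ (toPlane.symm p.1)) (toPlane.symm p.2), ?_, ?_, ?_⟩
  · rintro p ⟨hp, -⟩
    have hp0 : toPlane.symm p.1 ≠ 0 := fun h => hp (toPlane.symm.map_eq_zero_iff.1 h)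
    obtain ⟨r, hrc, hr⟩ := exists_continuousAt_sqrt hp0
    refine ContinuousAt.continuousWithinAt ?_
    have h1 : ContinuousAt (fun q : Plane × Plane => toPlane.symm q.1) p :=
      (toPlane.symm.continuous.comp continuous_fst).continuousAt
    have h2 : ContinuousAt (fun q : Plane × Plane => toPlane.symm q.2) p :=
      (toPlane.symm.continuous.comp continuous_snd).continuousAt
    have h3 := hYcont (fun q => r (toPlane.symm q.1)) (fun q => toPlane.symm q.2) p
      (ContinuousAt.comp (g := r) hrc h1) h2 (hne p.1 _ hp (hr _))
    refine h3.congr ?_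
    filter_upwards [continuous_fst.continuousAt.eventually_ne hp] with q hq
    rcases sq_eq_sq_iff_eq_or_eq_neg.1 ((hr (toPlane.symm q.1)).trans (hρ _).symm) with h | h
    · rw [h]
    · rw [h, hYneg _ _ (hne q.1 _ hq (hρ _))]
  · rintro ⟨x₀, v₀⟩ hp
    have hx₀ : x₀ ≠ 0 := by
      obtain ⟨q, x, v, hxv, hxp, -⟩ := hp
      have h1 : x 0 = x₀ := congrArg Prod.fst hxp
      exact h1 ▸ hxv.ne_zero 0 ⟨by linarith, le_rfl⟩
    set ζ := ρ (toPlane.symm x₀) with hζdef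
    set η := toPlane.symm v₀ with hη
    have hζ : ζ ≠ 0 := hne x₀ ζ hx₀ (hρ _)
    obtain ⟨hθ0, hθT⟩ := hθ ζ η hζ
    have hpeq : (toPlane ((Φ (regInitial ζ η, 0)).1 ^ 2),
        toPlane (keplerVelocity (Φ (regInitial ζ η, 0)).1 (Φ (regInitial ζ η, 0)).2.1)) =
        (x₀, v₀) := by
      rw [hΦ0]
      simp only [regInitial]
      rw [keplerVelocity_regInitial hζ, hζdef, hρ, hη]
      simp
    have h1 := (hcurve ζ η hζ).poincarePosition_eq hD hdD hθ0
    simp only [hpeq, hθT] at h1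
    exact (h1 hp).symm
  · intro x₀ hx₀ c
    set ζ := ρ (toPlane.symm x₀) with hζdef
    set η := toPlane.symm (c • x₀) with hη
    have hζ : ζ ≠ 0 := hne x₀ ζ hx₀ (hρ _)
    have hsq : ζ ^ 2 = toPlane.symm x₀ := hρ _
    have hw : (Φ (regInitial ζ η, 0)).2.1 = (-(c * Complex.normSq ζ / 2)) •
        (Φ (regInitial ζ η, 0)).1 := by
      rw [hΦ0]
      simp only [regInitial, hη, map_smul, ← hsq, Complex.real_smul]
      push_cast
      rw [← Complex.mul_conj]
      ring
    have hz0 : (Φ (regInitial ζ η, 0)).1 ≠ 0 := by rw [hΦ0]; exact hζ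
    obtain ⟨a, ha⟩ := (hcurve ζ η hζ).exists_eq_real_smul hd.continuous hz0 hw (hθ ζ η hζ).1
    refine ⟨a ^ 2, sq_nonneg a, ?_⟩
    have ha' : (Φ (regInitial ζ η, θ ζ η)).1 = a • ζ := by
      rw [hΦ0] at ha; exact ha
    show toPlane ((Φ (regInitial ζ η, θ ζ η)).1 ^ 2) = _
    rw [ha', smul_pow, hsq, map_smul, toPlane.apply_symm_apply]
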